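/- Graphs are undirected, without loops or multiple edges, and may be infinite; a circuit is the edge set of a finite cycle. A graph is 2-connected if it has at least three vertices and stays connected after the deletion of any one vertex. A circuit surjection $f:G\to H$ is a map of the edge set $E(G)$ onto $E(H)$ that takes every circuit of $G$ to a circuit of $H$, where $H$ has no isolated vertices; it is a circuit injection if it is moreover one-to-one on edges. A suspended chain of a graph is a finite path with at least three vertices whose interior vertices all have degree two in the graph. Theorem 1.1. Let $f:G\to H$ be a circuit surjection, where $G$ is 2-connected and $H$ is not a circuit. Then there are graphs $K$, $L$ without isolated vertices and edge maps $k:E(G)\to E(K)$, $h:E(K)\to E(L)$, $q:E(L)\to E(H)$ with $f=q\circ h\circ k$ such that: (i) $k$ is a bijection and preserves circuits in both directions: $C\subseteq E(G)$ is a circuit of $G$ if and only if $k(C)$ is a circuit of $K$. If $G$ is finite, $k$ is a 2-isomorphism in the sense of Whitney: $K$ is obtained from $G$, with the edge correspondence $k$, up to a bijection of the vertices, by finitely many 2-switchings. (A 2-switching splits the edge set into two parts having no common vertices other than two given vertices $u,v$, and interchanges $u$ and $v$ as ends of the edges of one of the parts.) (ii) $L$ arises from $K$ by replacing suspended chains,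 no two of which share an edge, by single edges joining their endpoints (all other edges, and all vertices that are not interior vertices of these chains, being kept), and $h$ is the resulting map of $E(K)$ onto $E(L)$. It preserves circuits in both directions: $h(C)$ is a circuit of $L$ for every circuit $C$ of $K$, and $h^{-1}(D)$ is a circuit of $K$ for every circuit $D$ of $L$. (iii) $q:L\to H$ is a circuit injection. In particular, $f^{-1}(e)$ is finite for every edge $e$ of $H$. -/

import Mathlib

universe u v

namespace CircuitMaps

/-- A graph is 2-connected: it has at least three vertices and stays connected when any one
vertex is deleted (it is then itself connected). The vertex set may be infinite. -/
def TwoConnected {V : Type*} (G : SimpleGraph V) : Prop :=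
  3 ≤ ENat.card V ∧ ∀ v : V, (G.induce {v}ᶜ).Connected

/-- A set of edges is a circuit if it is the edge set of a (finite) cycle. -/
def IsCircuit {V : Type*} (G : SimpleGraph V) (C : Set G.edgeSet) : Prop :=
  ∃ (v : V) (p : G.Walk v v), p.IsCycle ∧ ∀ e : G.edgeSet, e ∈ C ↔ (e : Sym2 V) ∈ p.edges

/-- A graph is a circuit: it has no isolated vertices and its whole edge set is a circuit. -/
def IsCircuitGraph {V : Type*} (G : SimpleGraph V) : Prop :=
  (∀ v : V, ¬ G.IsIsolated v) ∧ IsCircuit G Set.univ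

/-- A circuit surjection of `G` onto `H`: a map of the edges of `G` onto the edges of `H` taking
circuits to circuits; by convention `H` has no isolated vertices. -/
structure IsCircuitSurjection {V W : Type*} (G : SimpleGraph V) (H : SimpleGraph W)
    (f : G.edgeSet → H.edgeSet) : Prop where
  not_isIsolated : ∀ w : W, ¬ H.IsIsolated w
  surjective : Function.Surjective f
  map_circuit : ∀ C : Set G.edgeSet, IsCircuit G C → IsCircuit H (f '' C)

/-- A circuit injection: a circuit surjection which is one-to-one (hence bijective on edges). -/
structure IsCircuitInjection {V W : Type*} (G : SimpleGraph V) (H : SimpleGraph W)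
    (f : G.edgeSet → H.edgeSet) : Prop extends IsCircuitSurjection G H f where
  injective : Function.Injective f

/-- A one-to-one onto edge map preserving circuits in both directions: a set of edges is a
circuit if and only if its image is one. -/
structure IsCircuitIsomorphism {V W : Type*} (G : SimpleGraph V) (H : SimpleGraph W)
    (k : G.edgeSet → H.edgeSet) : Prop where
  not_isIsolated : ∀ w : W, ¬ H.IsIsolated w
  bijective : Function.Bijective k
  circuit_iff : ∀ C : Set G.edgeSet, IsCircuit G C ↔ IsCircuit H (k '' C)

open Classical in
/-- One 2-switching. A graph with edges indexed by `E` is given by the map sending each edge to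
its pair of end vertices. The edge set is split into `A` and its complement, which have no common
vertices other than `u` and `v`; the part `A` is turned around at `u` and `v`, that is,
the roles of `u` and `v` are interchanged in all the edges of `A` and in no others. -/
def Switching {V E : Type*} (φ ψ : E → Sym2 V) : Prop :=
  ∃ (u v : V) (A : Set E), u ≠ v ∧
    (∀ w : V, (∃ a ∈ A, w ∈ φ a) → (∃ b ∉ A, w ∈ φ b) → w = u ∨ w = v) ∧
    ∀ e : E, ψ e = if e ∈ A then (φ e).map (Equiv.swap u v) else φ e

/-- Whitney's 2-isomorphism (for finite 2-connected graphs): after finitely many 2-switchings of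
`G`, the edge map `k` is induced by a bijection of the vertices. -/
def IsTwoIsomorphism {V W : Type*} (G : SimpleGraph V) (K : SimpleGraph W)
    (k : G.edgeSet → K.edgeSet) : Prop :=
  ∃ φ : G.edgeSet → Sym2 V, Relation.ReflTransGen Switching (fun e : G.edgeSet => (e : Sym2 V)) φ ∧
    ∃ σ : V ≃ W, ∀ e : G.edgeSet, (k e : Sym2 W) = (φ e).map σ

/-- A suspended chain, as a walk between its endpoints: a path with at least three vertices
all of whose interior vertices have degree two in the whole graph. -/
def IsSuspendedChain {V : Type*} (G : SimpleGraph V) {u v : V} (p : G.Walk u v) : Prop :=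
  p.IsPath ∧ 2 ≤ p.length ∧
    ∀ w ∈ p.support, w ≠ u → w ≠ v → (G.neighborSet w).encard = 2

/-- `L` arises from `K` by replacing suspended chains by single edges, and `h` is the resulting
edge map. The vertices of `L` are vertices of `K` (through `ι`); the edges sent by `h` to the edge
`ab` of `L` are the edges of a walk of `K` from `ι a` to `ι b` which is a single edge or a
suspended chain, and which has no vertices of `L` in its interior; the vertices of `K` that are
lost all lie on edges, hence in the interior of those chains. -/
def ReplacesChains {V W : Type*} (K : SimpleGraph V) (L : SimpleGraph W)
    (h : K.edgeSet → L.edgeSet) : Prop :=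
  ∃ ι : W ↪ V,
    (∀ (a b : W) (_ : L.Adj a b), ∃ p : K.Walk (ι a) (ι b),
      (p.length = 1 ∨ IsSuspendedChain K p) ∧
      (∀ e : K.edgeSet, (h e : Sym2 W) = s(a, b) ↔ (e : Sym2 V) ∈ p.edges) ∧
      ∀ c : W, ι c ∈ p.support → c = a ∨ c = b) ∧
    ∀ v : V, v ∉ Set.range ι → ¬ K.IsIsolated v

end CircuitMaps

namespace CircuitMaps

/-! The heart of the matter is that every circuit of `G` is a union of fibres of `f`
(`IsBinarySpace.mem_of_apply_eq`, `IsCircuitSurjection.saturated`). Circuits are the minimal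
nonempty members of the cycle space over the field with two elements (`isCircuit_iff`), so this is
proved for binary spaces in which any two elements lie in a common minimal member. Suppose `f`
identifies `g` in a circuit `C` with `g'` outside `C`. An ear of `C` through `g'` gives a theta
whose three circuits must all have the same image. As `H` is not a circuit, some edge `e` has its
image elsewhere; add a second ear through `e`. The even sets through `e` in the resulting union form
a coset of the four even sets of the theta. Comparing images shows that, of three suitable members
of the coset, at most one is a circuit, while the shape of the theta forbids two of them to be
non-circuits.

Consequently the even sets of `G` are unions of fibres, and fibres are finite. Well-order the edges
and call the least edge of each fibre leading. Contracting all other edges gives `L`, and taking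
images under `f` matches the even sets of `G` with those of `L`. Inserting the contracted edges
again, in order, as subdivisions of the leading edges gives `K`; its even sets are again the
preimages of those of `L`, so `G` and `K` have the same even sets (`evenSpace_regroup`). Simplicity
of `K` and `L` is also read off from the even sets: none has just one or two edges.

If `G` is finite, a non-leading edge and its leading edge form a two-edge cut, and moving the former
to the end of the chain of the latter takes at most two switchings (`switchEquiv_of_cut`). The
graphs `regroup φ f S` interpolate between `G` (`S` empty) and `K` (`S = tails f`). -/

/-- A family of finite sets closed under symmetric difference, such as the cycle space of a
graph over the field with two elements. -/
structure IsBinarySpace {E : Type*} (M : Set (Set E)) : Prop where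
  finite : ∀ C ∈ M, C.Finite
  symmDiff_mem : ∀ C ∈ M, ∀ D ∈ M, symmDiff C D ∈ M

/-- The minimal nonempty members of a family of sets. -/
def IsMinimalMember {E : Type*} (M : Set (Set E)) (C : Set E) : Prop :=
  C ∈ M ∧ C.Nonempty ∧ ∀ D ∈ M, D ⊆ C → D.Nonempty → D = C

/-- Two elements are linked if some minimal member contains both. -/
def Linked {E : Type*} (M : Set (Set E)) (a b : E) : Prop :=
  ∃ C, IsMinimalMember M C ∧ a ∈ C ∧ b ∈ C

/-! ### Binary spaces: linking, ears, thetas, and maps preserving minimal members. -/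

section Abstract

variable {E F : Type*} {M : Set (Set E)} {N : Set (Set F)}

/-- A member `Y` that is not minimal splits into two smaller members `D` and `Y \ D`; descend into
the one containing `a`. -/
theorem IsBinarySpace.exists_isMinimalMember (hM : IsBinarySpace M) {Y : Set E} (hY : Y ∈ M)
    {a : E} (ha : a ∈ Y) : ∃ C, IsMinimalMember M C ∧ a ∈ C ∧ C ⊆ Y := by
  induction hn : Y.ncard using Nat.strong_induction_on generalizing Y with
  | _ n ih =>
    by_cases h : IsMinimalMember M Y
    · exact ⟨Y, h, ha, subset_rfl⟩
    · have : ∃ D ∈ M, D ⊂ Y ∧ D.Nonempty := by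
        by_contra! hcon
        refine h ⟨hY, ⟨a, ha⟩, fun D hD hDY hne => ?_⟩
        by_contra hDne
        exact (hne.ne_empty) (hcon D hD (hDY.ssubset_of_ne hDne))
      obtain ⟨D, hD, hDY, hDne⟩ := this
      by_cases haD : a ∈ D
      · obtain ⟨C, hC, haC, hCD⟩ := ih _ (hn ▸ Set.ncard_lt_ncard hDY (hM.finite _ hY)) hD haD rfl
        exact ⟨C, hC, haC, hCD.trans hDY.subset⟩
      · have hE := hM.symmDiff_mem _ hY _ hD
        have heq : symmDiff Y D = Y \ D := by
          rw [Set.symmDiff_def, Set.sdiff_eq_empty.2 hDY.subset, Set.union_empty]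
        rw [heq] at hE
        have hss : Y \ D ⊂ Y := by
          refine ⟨Set.sdiff_subset, fun h => ?_⟩
          obtain ⟨d, hd⟩ := hDne
          exact (h (hDY.subset hd)).2 hd
        obtain ⟨C, hC, haC, hCD⟩ := ih _ (hn ▸ Set.ncard_lt_ncard hss (hM.finite _ hY)) hE
          ⟨ha, haD⟩ rfl
        exact ⟨C, hC, haC, hCD.trans Set.sdiff_subset⟩

theorem IsMinimalMember.eq_of_subset {C D : Set E} (hC : IsMinimalMember M C)
    (hD : IsMinimalMember M D) (h : D ⊆ C) : D = C :=
  hC.2.2 D hD.1 h hD.2.1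

theorem IsMinimalMember.exists_mem_notMem {C D : Set E} (hC : IsMinimalMember M C)
    (hD : IsMinimalMember M D) {b : E} (hb : b ∈ C) (hbD : b ∉ D) : ∃ x ∈ D, x ∉ C := by
  by_contra! h
  have := hC.eq_of_subset hD h
  exact hbD (this ▸ hb)

/-- Take a minimal member `A` through `a` inside the sum of `C` and `D`. If it misses `c`, what
remains of the sum contains a minimal `B` through `c`, disjoint from `A`. Then `A` meets `D`, and
`C` can be replaced by `A`. -/
theorem IsBinarySpace.linked_of_inter (hM : IsBinarySpace M) {C D : Set E}
    (hC : IsMinimalMember M C) (hD : IsMinimalMember M D) {a c : E} (ha : a ∈ C) (hc : c ∈ D)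
    (hCD : (C ∩ D).Nonempty) : Linked M a c := by
  induction hn : (C ∪ D).ncard using Nat.strong_induction_on generalizing C D with
  | _ n ih =>
    by_cases hcC : c ∈ C
    · exact ⟨C, hC, ha, hcC⟩
    by_cases haD : a ∈ D
    · exact ⟨D, hD, haD, hc⟩
    have hfin : (C ∪ D).Finite := (hM.finite _ hC.1).union (hM.finite _ hD.1)
    have hS := hM.symmDiff_mem _ hC.1 _ hD.1
    obtain ⟨b, hbC, hbD⟩ := hCD
    obtain ⟨A, hA, haA, hAS⟩ := hM.exists_isMinimalMember hS (a := a) (Or.inl ⟨ha, haD⟩)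
    by_cases hcA : c ∈ A
    · exact ⟨A, hA, haA, hcA⟩
    have hS' := hM.symmDiff_mem _ hS _ hA.1
    obtain ⟨B, hB, hcB, hBS⟩ := hM.exists_isMinimalMember hS' (a := c)
      (Or.inl ⟨Or.inr ⟨hc, hcC⟩, hcA⟩)
    have hbA : b ∉ A := fun h => by
      have := hAS h
      simp [Set.mem_symmDiff, hbC, hbD] at this
    have hBS2 : ∀ x ∈ B, x ∉ A ∧ x ∈ symmDiff C D := by
      intro x hx
      rcases hBS hx with h | h
      · exact ⟨h.2, h.1⟩
      · exact absurd (hAS h.1) h.2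
    have hbB : b ∉ B := fun h => by
      have := (hBS2 b h).2
      simp [Set.mem_symmDiff, hbC, hbD] at this
    obtain ⟨x, hxA, hxC⟩ := hC.exists_mem_notMem hA hbC hbA
    obtain ⟨y, hyB, hyD⟩ := hD.exists_mem_notMem hB hbD hbB
    have hxD : x ∈ D := by
      rcases hAS hxA with h | h
      · exact absurd h.1 hxC
      · exact h.1
    have hyC : y ∈ C := by
      rcases (hBS2 y hyB).2 with h | h
      · exact h.1
      · exact absurd h.1 hyD
    -- The union shrinks because `y` lies in `C` but neither in `A` nor in `D`.
    refine ih _ ?_ hA hD haA hc ⟨x, hxA, hxD⟩ rfl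
    rw [← hn]
    refine Set.ncard_lt_ncard ⟨?_, fun h => ?_⟩ hfin
    · refine Set.union_subset (fun z hz => ?_) Set.subset_union_right
      rcases hAS hz with h | h
      · exact Or.inl h.1
      · exact Or.inr h.1
    · rcases h (Or.inl hyC) with h | h
      · exact (hBS2 y hyB).1 h
      · exact hyD h

theorem Linked.trans (hM : IsBinarySpace M) {a b c : E} (hab : Linked M a b)
    (hbc : Linked M b c) : Linked M a c := by
  obtain ⟨C, hC, ha, hb⟩ := hab
  obtain ⟨D, hD, hb', hc⟩ := hbc
  exact hM.linked_of_inter hC hD ha hc ⟨b, hb, hb'⟩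

theorem Linked.symm {a b : E} (hab : Linked M a b) : Linked M b a := by
  obtain ⟨C, hC, ha, hb⟩ := hab
  exact ⟨C, hC, hb, ha⟩

/-- A minimal member through `e` that meets `S` and leaves it as little as possible. -/
theorem IsBinarySpace.exists_ear (hM : IsBinarySpace M) (hlink : ∀ a b : E, Linked M a b)
    {S : Set E} (hS : S.Nonempty) (e : E) :
    ∃ X, IsMinimalMember M X ∧ e ∈ X ∧ 
      ∀ Y ∈ M, Y ⊆ S ∪ X → e ∈ Y → X \ S ⊆ Y ∧ (S ∩ Y).Nonempty := by
  obtain ⟨s, hs⟩ := hS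
  have hex : ∃ n : ℕ, ∃ X, IsMinimalMember M X ∧ e ∈ X ∧ (S ∩ X).Nonempty ∧ (X \ S).ncard = n := by
    obtain ⟨X, hX, hsX, heX⟩ := hlink s e
    exact ⟨_, X, hX, heX, ⟨s, hs, hsX⟩, rfl⟩
  classical
  obtain ⟨X, hX, heX, hSX, hn⟩ := Nat.find_spec hex
  have hmin := fun m (hm : m < Nat.find hex) => Nat.find_min hex hm
  refine ⟨X, hX, heX, fun Y hY hYS heY => ?_⟩
  obtain ⟨Z, hZ, heZ, hZY⟩ := hM.exists_isMinimalMember hY heY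
  have hSZ : (S ∩ Z).Nonempty := by
    by_contra h
    have hdis : ∀ z ∈ Z, z ∉ S := fun z hz hzS => h ⟨z, hzS, hz⟩
    have hZX : Z ⊆ X := fun z hz => (hYS (hZY hz)).resolve_left (hdis z hz)
    have := hX.eq_of_subset hZ hZX
    obtain ⟨t, htS, htX⟩ := hSX
    exact hdis t (this ▸ htX) htS
  have hsub : Z \ S ⊆ X \ S := fun z hz => ⟨(hYS (hZY hz.1)).resolve_left hz.2, hz.2⟩
  have hfin : (X \ S).Finite := (hM.finite _ hX.1).subset Set.sdiff_subset
  have heq : Z \ S = X \ S := by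
    refine Set.eq_of_subset_of_ncard_le hsub ?_ hfin
    by_contra hlt
    push Not at hlt
    rw [hn] at hlt
    exact hmin _ hlt ⟨Z, hZ, heZ, hSZ, rfl⟩
  refine ⟨heq ▸ Set.sdiff_subset.trans hZY, ?_⟩
  obtain ⟨t, htS, htZ⟩ := hSZ
  exact ⟨t, htS, hZY htZ⟩

/-- Three minimal members with sum zero either have the same image, or their pairwise
intersections have disjoint images. -/
theorem image_eq_or_disjoint (hN : IsBinarySpace N) {f : E → F}
    (hf : ∀ C, IsMinimalMember M C → IsMinimalMember N (f '' C)) {C X : Set E}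
    (hC : IsMinimalMember M C) (hX : IsMinimalMember M X)
    (hCX : IsMinimalMember M (symmDiff C X)) :
    f '' C = f '' X ∨ ∀ g ∈ C ∪ X, ∀ g' ∈ C ∪ X, f g = f g' →
      (g ∈ C ↔ g' ∈ C) ∧ (g ∈ X ↔ g' ∈ X) := by
  by_cases heq : f '' C = f '' X
  · exact Or.inl heq
  right
  have hD := hf _ hC
  have hD' := hf _ hX
  have hD'' := hf _ hCX
  have hne : (symmDiff (f '' C) (f '' X)).Nonempty := by
    rw [Set.nonempty_iff_ne_empty]
    intro h
    exact heq (symmDiff_eq_bot.1 h)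
  have hsub : symmDiff (f '' C) (f '' X) ⊆ f '' symmDiff C X := by
    rintro _ (⟨⟨g, hg, rfl⟩, h⟩ | ⟨⟨g, hg, rfl⟩, h⟩)
    · exact ⟨g, Or.inl ⟨hg, fun hgX => h ⟨g, hgX, rfl⟩⟩, rfl⟩
    · exact ⟨g, Or.inr ⟨hg, fun hgX => h ⟨g, hgX, rfl⟩⟩, rfl⟩
  -- The sum of the images of `C` and `X` is a nonempty member inside the image of their sum, hence
  -- equal to it; so no edge of `symmDiff C X` has its image in both `f '' C` and `f '' X`.
  have key := hD''.2.2 _ (hN.symmDiff_mem _ hD.1 _ hD'.1) hsub hne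
  have key2 : ∀ g, g ∈ symmDiff C X → ¬ (f g ∈ f '' C ∧ f g ∈ f '' X) := by
    intro g hg ⟨h1, h2⟩
    have : f g ∈ symmDiff (f '' C) (f '' X) := key ▸ Set.mem_image_of_mem f hg
    rcases this with h | h
    · exact h.2 h2
    · exact h.2 h1
  have aux : ∀ g ∈ C ∪ X, ∀ g' ∈ C ∪ X, f g = f g' → (g ∈ C → g' ∈ C) ∧ (g ∈ X → g' ∈ X) := by
    intro g hg g' hg' hgg
    constructor
    · intro hgC
      by_contra hgC'
      have hX' : g' ∈ X := hg'.resolve_left hgC'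
      exact key2 g' (Or.inr ⟨hX', hgC'⟩) ⟨⟨g, hgC, hgg⟩, ⟨g', hX', rfl⟩⟩
    · intro hgX
      by_contra hgX'
      have hC' : g' ∈ C := hg'.resolve_right hgX'
      exact key2 g' (Or.inl ⟨hC', hgX'⟩) ⟨⟨g', hC', rfl⟩, ⟨g, hgX, hgg⟩⟩
  intro g hg g' hg' hgg
  have h1 := aux g hg g' hg' hgg
  have h2 := aux g' hg' g hg hgg.symm
  exact ⟨⟨h1.1, h2.1⟩, ⟨h1.2, h2.2⟩⟩

theorem symmDiff_union_right (C X : Set E) : symmDiff C X ∪ X = C ∪ X := by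
  ext x
  simp only [Set.mem_symmDiff, Set.mem_union]
  tauto

/-- Add to `C` an ear through `g'`. Any member inside the union that contains `g'` contains the
whole ear, so it differs from `X` by a member inside `C`, that is, by `∅` or `C`. -/
theorem IsBinarySpace.exists_theta (hM : IsBinarySpace M) (hlink : ∀ a b : E, Linked M a b)
    {C : Set E} (hC : IsMinimalMember M C) {g g' : E} (hg : g ∈ C) (hg' : g' ∉ C) :
    ∃ X, IsMinimalMember M X ∧ IsMinimalMember M (symmDiff C X) ∧ g ∈ X ∧ g' ∈ X ∧
      ∀ W ∈ M, W ⊆ C ∪ X → W = ∅ ∨ W = C ∨ W = X ∨ W = symmDiff C X := by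
  obtain ⟨X, hX, hgX, hear⟩ := hM.exists_ear hlink ⟨g, hg⟩ g'
  have hsub : ∀ W ∈ M, W ⊆ C → W = ∅ ∨ W = C := fun W hW hWC => by
    rcases W.eq_empty_or_nonempty with h | h
    · exact Or.inl h
    · exact Or.inr (hC.2.2 W hW hWC h)
  have hclass' : ∀ W ∈ M, W ⊆ C ∪ X → g' ∈ W → W = X ∨ W = symmDiff C X := by
    intro W hW hWS hgW
    have h1 := (hear W hW hWS hgW).1
    have h2 : symmDiff W X ⊆ C := by
      rintro x (⟨hx, hx'⟩ | ⟨hx, hx'⟩)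
      · exact (hWS hx).resolve_right hx'
      · by_contra hxC
        exact hx' (h1 ⟨hx, hxC⟩)
    rcases hsub _ (hM.symmDiff_mem _ hW _ hX.1) h2 with h | h
    · exact Or.inl (symmDiff_eq_bot.1 h)
    · exact Or.inr (by rw [← h, symmDiff_symmDiff_cancel_right])
  have hclass : ∀ W ∈ M, W ⊆ C ∪ X → W = ∅ ∨ W = C ∨ W = X ∨ W = symmDiff C X := by
    intro W hW hWS
    by_cases hgW : g' ∈ W
    · exact Or.inr (Or.inr (hclass' W hW hWS hgW))
    · have h1 : symmDiff W X ⊆ C ∪ X := by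
        rintro x (⟨hx, hx'⟩ | ⟨hx, hx'⟩)
        · exact hWS hx
        · exact Or.inr hx
      rcases hclass' _ (hM.symmDiff_mem _ hW _ hX.1) h1 (Or.inr ⟨hgX, hgW⟩) with h | h
      · exact Or.inl (symmDiff_eq_right.1 h)
      · exact Or.inr (Or.inl (symmDiff_left_injective X h))
  have hCX : IsMinimalMember M (symmDiff C X) := by
    have hmem := hM.symmDiff_mem _ hC.1 _ hX.1
    obtain ⟨Y, hY, hgY, hYs⟩ := hM.exists_isMinimalMember hmem (a := g') (Or.inr ⟨hgX, hg'⟩)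
    have hYs' : Y ⊆ C ∪ X := hYs.trans (by
      rintro x (⟨hx, hx'⟩ | ⟨hx, hx'⟩)
      · exact Or.inl hx
      · exact Or.inr hx)
    rcases hclass' Y hY.1 hYs' hgY with rfl | rfl
    · obtain ⟨x, hxC, hxX⟩ := (hear Y hX.1 Set.subset_union_right hgX).2
      rcases hYs hxX with h | h
      · exact absurd hxX h.2
      · exact absurd hxC h.2
    · exact hY
  -- Both `X` and `symmDiff C X` contain `g'`, and exactly one of them contains `g`; that one is
  -- chosen.
  by_cases hgX' : g ∈ X
  · exact ⟨X, hX, hCX, hgX', hgX, hclass⟩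
  · refine ⟨symmDiff C X, hCX, ?_, Or.inl ⟨hg, hgX'⟩, Or.inr ⟨hgX, hg'⟩, ?_⟩
    · rwa [symmDiff_symmDiff_cancel_left]
    · intro W hW hWS
      rw [symmDiff_symmDiff_cancel_left]
      have := hclass W hW (hWS.trans (by
        rintro x (hx | ⟨hx, hx'⟩ | ⟨hx, hx'⟩)
        · exact Or.inl hx
        · exact Or.inl hx
        · exact Or.inr hx))
      tauto

theorem IsMinimalMember.inter_nonempty {C X : Set E} (hC : IsMinimalMember M C)
    (hX : IsMinimalMember M X) (hCX : IsMinimalMember M (symmDiff C X)) : (C ∩ X).Nonempty := by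
  by_contra h
  rw [Set.not_nonempty_iff_eq_empty] at h
  have hCs : C ⊆ symmDiff C X := fun x hx => Or.inl ⟨hx, fun hx' => by
    have : x ∈ C ∩ X := ⟨hx, hx'⟩
    simp [h] at this⟩
  have := hCX.eq_of_subset hC hCs
  obtain ⟨x, hx⟩ := hX.2.1
  have hxC : x ∈ C := by
    rw [this]
    refine Or.inr ⟨hx, fun hxC => ?_⟩
    have : x ∈ C ∩ X := ⟨hxC, hx⟩
    simp [h] at this
  have : x ∈ C ∩ X := ⟨hxC, hx⟩
  simp [h] at this

/-- Here `A`, `B`, `D` are the circuits of a theta. A non-minimal `W` splits off one of them; it is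
not `A`, since the rest would be `U`, and likewise for `U`. If both split off the same one of `B`
and `D`, the edges it shares with `A` would lie in both `W` and `U`. Otherwise `W` agrees on the
theta with `B` or with `D`, and removing that circuit leaves a set missing the theta. -/
theorem not_two_nonminimal {A B D W U : Set E} (hAB : (A ∩ B).Nonempty) (hBA : (A \ B).Nonempty)
    (hD : D = symmDiff A B) (hU : U = symmDiff W A)
    (hW : ¬ IsMinimalMember M W) (hU' : ¬ IsMinimalMember M U)
    (hWi : ∃ T, (T = A ∨ T = B ∨ T = D) ∧ T ⊆ W ∧ IsMinimalMember M (symmDiff W T))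
    (hUi : ∃ T, (T = A ∨ T = B ∨ T = D) ∧ T ⊆ U ∧ IsMinimalMember M (symmDiff U T))
    (hB : ((A ∪ B) ∩ symmDiff W B).Nonempty) (hDm : ((A ∪ B) ∩ symmDiff W D).Nonempty) : False := by
  subst hD hU
  obtain ⟨T, hT, hTW, hTm⟩ := hWi
  obtain ⟨R, hR, hRU, hRm⟩ := hUi
  obtain ⟨a, haA, haB⟩ := hAB
  obtain ⟨b, hbA, hbB⟩ := hBA
  rcases hT with rfl | rfl | rfl
  · exact hU' hTm
  · rcases hR with rfl | rfl | rfl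
    · rw [symmDiff_symmDiff_cancel_right] at hRm
      exact hW hRm
    · have h1 := hTW haB
      have h2 := hRU haB
      simp [Set.mem_symmDiff, h1, haA] at h2
    · obtain ⟨x, hx, hx'⟩ := hB
      have h1 := @hTW x
      have h2 := @hRU x
      simp only [Set.mem_symmDiff, Set.mem_union] at *
      tauto
  · rcases hR with rfl | rfl | rfl
    · rw [symmDiff_symmDiff_cancel_right] at hRm
      exact hW hRm
    · obtain ⟨x, hx, hx'⟩ := hDm
      have h1 := @hTW x
      have h2 := @hRU x
      simp only [Set.mem_symmDiff, Set.mem_union] at *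
      tauto
    · have h1 := @hTW b
      have h2 := @hRU b
      simp only [Set.mem_symmDiff] at *
      tauto

/-- A map of a connected binary space taking minimal members to minimal members, none of which
is everything, identifies no element of a minimal member with an element outside of it. -/
theorem IsBinarySpace.mem_of_apply_eq (hM : IsBinarySpace M) (hN : IsBinarySpace N)
    (hlink : ∀ a b : E, Linked M a b) {f : E → F}
    (hf : ∀ C, IsMinimalMember M C → IsMinimalMember N (f '' C))
    (hne : ∀ C, IsMinimalMember M C → ∃ e, f e ∉ f '' C) {C : Set E}
    (hC : IsMinimalMember M C) {g g' : E} (hg : g ∈ C) (hgg : f g = f g') : g' ∈ C := by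
  by_contra hg'
  obtain ⟨X, hX, hCX, hgX, hgX', hclass⟩ := hM.exists_theta hlink hC hg hg'
  have hXX : symmDiff C (symmDiff C X) = X := symmDiff_symmDiff_cancel_left C X
  obtain ⟨e, he⟩ := hne C hC
  have him1 : f '' C = f '' X := by
    rcases image_eq_or_disjoint hN hf hC hX hCX with h | h
    · exact h
    · exact absurd ((h g (Or.inl hg) g' (Or.inr hgX') hgg).1.1 hg) hg'
  have him2 : f '' C = f '' symmDiff C X := by
    rcases image_eq_or_disjoint hN hf hC hCX (by rw [hXX]; exact hX) with h | h
    · exact h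
    · exact absurd ((h g (Or.inl hg) g' (Or.inr (Or.inr ⟨hgX', hg'⟩)) hgg).1.1 hg) hg'
  -- All three circuits of the theta have the same image, which avoids `f e`; the second ear brings
  -- in `e`.
  obtain ⟨Z, hZ, heZ, hear⟩ := hM.exists_ear hlink (S := C ∪ X) ⟨g, Or.inl hg⟩ e
  have heC : e ∉ C := fun h => he ⟨e, h, rfl⟩
  have heX : e ∉ X := fun h => he (him1 ▸ ⟨e, h, rfl⟩)
  have hnonmin : ∀ W ∈ M, W ⊆ C ∪ X ∪ Z → e ∈ W → ¬ IsMinimalMember M W →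
      ∃ T, (T = C ∨ T = X ∨ T = symmDiff C X) ∧ T ⊆ W ∧ IsMinimalMember M (symmDiff W T) := by
    intro W hW hWS heW hWn
    obtain ⟨Y, hY, heY, hYW⟩ := hM.exists_isMinimalMember hW heW
    have h1 := (hear Y hY.1 (hYW.trans hWS) heY).1
    have h2 : symmDiff W Y ⊆ C ∪ X := by
      rintro x (⟨hx, hx'⟩ | ⟨hx, hx'⟩)
      · by_contra hxS
        exact hx' (h1 ⟨(hWS hx).resolve_left hxS, hxS⟩)
      · exact absurd (hYW hx) hx'
    have h3 : symmDiff W Y ⊆ W := by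
      rintro x (⟨hx, hx'⟩ | ⟨hx, hx'⟩)
      · exact hx
      · exact hYW hx
    have h4 : IsMinimalMember M (symmDiff W (symmDiff W Y)) := by
      rwa [symmDiff_symmDiff_cancel_left]
    rcases hclass _ (hM.symmDiff_mem _ hW _ hY.1) h2 with h | h
    · exact absurd ((symmDiff_eq_bot.1 h) ▸ hY) hWn
    · exact ⟨_, h, h3, h4⟩
  -- Adding `C`, `X` or their sum to `Z` changes membership of `g'` only, of `g` only... as needed:
  -- `C` toggles `g`, the sum toggles `g'`, and `X` toggles both.
  obtain ⟨Y, hY, hYS, heY, hgY, hgY'⟩ :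
      ∃ Y ∈ M, Y ⊆ C ∪ X ∪ Z ∧ e ∈ Y ∧ g ∈ Y ∧ g' ∈ Y := by
    have hcases : ∀ T ∈ M, T ⊆ C ∪ X → symmDiff Z T ∈ M ∧ symmDiff Z T ⊆ C ∪ X ∪ Z ∧
        e ∈ symmDiff Z T := by
      intro T hT hTS
      refine ⟨hM.symmDiff_mem _ hZ.1 _ hT, ?_, Or.inl ⟨heZ, fun h => (hTS h).elim heC heX⟩⟩
      rintro x (⟨hx, hx'⟩ | ⟨hx, hx'⟩)
      · exact Or.inr hx
      · exact Or.inl (hTS hx)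
    by_cases h1 : g ∈ Z <;> by_cases h2 : g' ∈ Z
    · exact ⟨Z, hZ.1, Set.subset_union_right, heZ, h1, h2⟩
    · obtain ⟨a, b, c⟩ := hcases _ hCX.1 (by
        rintro x (⟨hx, hx'⟩ | ⟨hx, hx'⟩)
        · exact Or.inl hx
        · exact Or.inr hx)
      exact ⟨_, a, b, c, by simp only [Set.mem_symmDiff]; tauto,
        by simp only [Set.mem_symmDiff]; tauto⟩
    · obtain ⟨a, b, c⟩ := hcases _ hC.1 Set.subset_union_left
      exact ⟨_, a, b, c, by simp only [Set.mem_symmDiff]; tauto,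
        by simp only [Set.mem_symmDiff]; tauto⟩
    · obtain ⟨a, b, c⟩ := hcases _ hX.1 Set.subset_union_right
      exact ⟨_, a, b, c, by simp only [Set.mem_symmDiff]; tauto,
        by simp only [Set.mem_symmDiff]; tauto⟩
  have hshift : ∀ W ∈ M, W ⊆ C ∪ X ∪ Z → e ∈ W → ∀ T ∈ M, T ⊆ C ∪ X → symmDiff W T ∈ M ∧
      symmDiff W T ⊆ C ∪ X ∪ Z ∧ e ∈ symmDiff W T := by
    intro W hW hWS heW T hT hTS
    refine ⟨hM.symmDiff_mem _ hW _ hT, ?_, Or.inl ⟨heW, fun h => (hTS h).elim heC heX⟩⟩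
    rintro x (⟨hx, hx'⟩ | ⟨hx, hx'⟩)
    · exact hWS hx
    · exact Or.inl (hTS hx)
  have hCS : C ⊆ C ∪ X := Set.subset_union_left
  have hXS : X ⊆ C ∪ X := Set.subset_union_right
  have hCXS : symmDiff C X ⊆ C ∪ X := by
    rintro x (⟨hx, hx'⟩ | ⟨hx, hx'⟩)
    · exact Or.inl hx
    · exact Or.inr hx
  obtain ⟨h1M, h1S, h1e⟩ := hshift Y hY hYS heY C hC.1 hCS
  obtain ⟨h2M, h2S, h2e⟩ := hshift Y hY hYS heY X hX.1 hXS
  obtain ⟨h3M, h3S, h3e⟩ := hshift Y hY hYS heY _ hCX.1 hCXS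
  have hsep : ∀ W T : Set E, e ∈ W → IsMinimalMember M W → IsMinimalMember M T →
      f '' T = f '' C → IsMinimalMember M (symmDiff W T) → g ∈ W ∪ T → g' ∈ W ∪ T →
      (g ∈ W ↔ g' ∈ W) ∧ (g ∈ T ↔ g' ∈ T) := by
    intro W T heW hW hT hTC hWT h1 h2
    rcases image_eq_or_disjoint hN hf hW hT hWT with h | h
    · exact absurd (hTC ▸ h ▸ ⟨e, heW, rfl⟩) he
    · exact h g h1 g' h2 hgg
  have e1 : symmDiff (symmDiff Y C) X = symmDiff Y (symmDiff C X) := symmDiff_assoc _ _ _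
  -- Two minimal members through `e` that differ by a circuit of the theta have images unlike that
  -- of the circuit, so neither they nor the circuit can separate `g` from `g'`. Each of the three
  -- pairs below would do so; hence at most one of the three sets is minimal.
  have h12 : ¬ (IsMinimalMember M Y ∧ IsMinimalMember M (symmDiff Y C)) := fun ⟨h, h'⟩ =>
    hg' ((hsep Y C heY h hC rfl h' (Or.inl hgY) (Or.inl hgY')).2.1 hg)
  have h13 : ¬ (IsMinimalMember M Y ∧ IsMinimalMember M (symmDiff Y (symmDiff C X))) :=
    fun ⟨h, h'⟩ => by
      have := (hsep Y _ heY h hCX him2.symm h' (Or.inl hgY) (Or.inl hgY')).2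
      simp [Set.mem_symmDiff, hg, hg', hgX, hgX'] at this
  have h23 : ¬ (IsMinimalMember M (symmDiff Y C) ∧
      IsMinimalMember M (symmDiff Y (symmDiff C X))) := fun ⟨h, h'⟩ => by
    have := (hsep _ X h1e h hX him1.symm (e1 ▸ h') (Or.inr hgX) (Or.inr hgX')).1
    simp [Set.mem_symmDiff, hg, hg', hgY, hgY'] at this
  have hi := hC.inter_nonempty hX hCX
  have hCdX : (C \ X).Nonempty := by
    have := hCX.inter_nonempty hC (by
      rw [symmDiff_comm (symmDiff C X), hXX]; exact hX)
    obtain ⟨x, hx, hxC⟩ := this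
    refine ⟨x, hxC, fun hxX => ?_⟩
    simp [Set.mem_symmDiff, hxC, hxX] at hx
  have hXdC : (X \ C).Nonempty := ⟨g', hgX', hg'⟩
  have m1 := (hear _ h1M h1S h1e).2
  have m2 := (hear _ h2M h2S h2e).2
  have m3 := (hear _ h3M h3S h3e).2
  have n0 := hnonmin _ hY hYS heY
  have n1 := hnonmin _ h1M h1S h1e
  have n3 := hnonmin _ h3M h3S h3e
  by_cases c0 : IsMinimalMember M Y
  · exact not_two_nonminimal (M := M) (A := X) (B := C) (D := symmDiff C X) (W := symmDiff Y C)
      (U := symmDiff Y (symmDiff C X)) (by rwa [Set.inter_comm]) hXdC (symmDiff_comm _ _) e1.symm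
      (fun h => h12 ⟨c0, h⟩) (fun h => h13 ⟨c0, h⟩)
      (by obtain ⟨T, hT, h⟩ := n1 (fun h => h12 ⟨c0, h⟩); exact ⟨T, or_left_comm.1 hT, h⟩)
      (by obtain ⟨T, hT, h⟩ := n3 (fun h => h13 ⟨c0, h⟩); exact ⟨T, or_left_comm.1 hT, h⟩)
      (by rw [symmDiff_symmDiff_cancel_right, Set.union_comm]; exact (hear _ hY hYS heY).2)
      (by rw [symmDiff_assoc, hXX, Set.union_comm]; exact m2)
  · by_cases c1 : IsMinimalMember M (symmDiff Y C)
    · have c3 : ¬ IsMinimalMember M (symmDiff Y (symmDiff C X)) := fun h => h23 ⟨c1, h⟩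
      have hu : symmDiff C X ∪ X = C ∪ X := symmDiff_union_right C X
      have hperm : ∀ T, T = C ∨ T = X ∨ T = symmDiff C X → T = symmDiff C X ∨ T = X ∨ T = C :=
        fun T h => h.elim (fun h => Or.inr (Or.inr h)) fun h =>
          h.elim (fun h => Or.inr (Or.inl h)) Or.inl
      refine not_two_nonminimal (M := M) (A := symmDiff C X) (B := X) (D := C) (W := Y)
        (U := symmDiff Y (symmDiff C X)) ⟨g', Or.inr ⟨hgX', hg'⟩, hgX'⟩ ?_
        (symmDiff_symmDiff_cancel_right _ _).symm rfl c0 c3 ?_ ?_ (hu.symm ▸ m2) (hu.symm ▸ m1)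
      · obtain ⟨x, hx, hx'⟩ := hCdX
        exact ⟨x, Or.inl ⟨hx, hx'⟩, hx'⟩
      · obtain ⟨T, hT, h⟩ := n0 c0; exact ⟨T, hperm T hT, h⟩
      · obtain ⟨T, hT, h⟩ := n3 c3; exact ⟨T, hperm T hT, h⟩
    · exact not_two_nonminimal (M := M) (A := C) (B := X) (W := Y) hi hCdX rfl rfl c0 c1
        (n0 c0) (n1 c1) m2 m3

end Abstract

/-! ### The cycle space of a graph; circuits as its minimal members. -/

section Even

variable {V W E F : Type*}

/-- The sum, over the field with two elements, of the two ends of an edge. -/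
noncomputable def bd : Sym2 V → V →₀ ZMod 2 :=
  Sym2.lift ⟨fun a b => Finsupp.single a 1 + Finsupp.single b 1, fun _ _ => add_comm _ _⟩

theorem bd_mk (a b : V) : bd s(a, b) = Finsupp.single a 1 + Finsupp.single b 1 := rfl

theorem add_self_finsupp (x : V →₀ ZMod 2) : x + x = 0 := by
  ext v
  exact CharTwo.add_self_eq_zero (x v)

theorem bd_diag (a : V) : bd s(a, a) = 0 := add_self_finsupp _

theorem mapDomain_bd (c : V → W) (s : Sym2 V) : Finsupp.mapDomain c (bd s) = bd (s.map c) := by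
  induction s with
  | _ a b => rw [Sym2.map_mk, bd_mk, bd_mk, Finsupp.mapDomain_add, Finsupp.mapDomain_single,
      Finsupp.mapDomain_single]

/-- The finite sets of edges with an even number of edge ends at each vertex. -/
def evenSpace (φ : E → Sym2 V) : Set (Set E) :=
  {C | C.Finite ∧ ∑ᶠ e ∈ C, bd (φ e) = 0}

theorem finsum_symmDiff {C D : Set E} (hC : C.Finite) (hD : D.Finite) (g : E → V →₀ ZMod 2) :
    ∑ᶠ e ∈ symmDiff C D, g e = ∑ᶠ e ∈ C, g e + ∑ᶠ e ∈ D, g e := by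
  rw [← finsum_mem_inter_add_sdiff D hC, ← finsum_mem_inter_add_sdiff C hD, Set.inter_comm D C,
    Set.symmDiff_def, finsum_mem_union disjoint_sdiff_sdiff (hC.subset Set.sdiff_subset)
    (hD.subset Set.sdiff_subset)]
  have := add_self_finsupp (∑ᶠ e ∈ C ∩ D, g e)
  rw [add_add_add_comm, this, zero_add]

theorem isBinarySpace_evenSpace (φ : E → Sym2 V) : IsBinarySpace (evenSpace φ) where
  finite _ hC := hC.1
  symmDiff_mem C hC D hD := by
    refine ⟨(hC.1.union hD.1).subset ?_, ?_⟩
    · rintro x (⟨hx, hx'⟩ | ⟨hx, hx'⟩)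
      · exact Or.inl hx
      · exact Or.inr hx
    · rw [finsum_symmDiff hC.1 hD.1, hC.2, hD.2, add_zero]

/-- An edge crosses a set of vertices if it has one end inside and one end outside. -/
def Crosses (A : Set V) (s : Sym2 V) : Prop := ∃ u ∈ A, ∃ v ∉ A, s = s(u, v)

theorem crosses_mk {A : Set V} {a b : V} : Crosses A s(a, b) ↔ ¬ (a ∈ A ↔ b ∈ A) := by
  constructor
  · rintro ⟨u, hu, v, hv, h⟩
    rcases Sym2.eq_iff.1 h with ⟨rfl, rfl⟩ | ⟨rfl, rfl⟩ <;> tauto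
  · intro h
    by_cases ha : a ∈ A
    · exact ⟨a, ha, b, by tauto, rfl⟩
    · exact ⟨b, by tauto, a, ha, Sym2.eq_swap⟩

open Classical in
/-- The sum of the coefficients over a set of vertices. -/
noncomputable def sumOver (A : Set V) : (V →₀ ZMod 2) →+ ZMod 2 :=
  Finsupp.liftAddHom fun v => if v ∈ A then AddMonoidHom.id _ else 0

open Classical in
theorem sumOver_bd (A : Set V) (s : Sym2 V) : sumOver A (bd s) = if Crosses A s then 1 else 0 := by
  induction s with
  | _ a b =>
    have h2 : (1 : ZMod 2) + 1 = 0 := rfl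
    rw [bd_mk, map_add]
    simp only [sumOver, Finsupp.liftAddHom_apply_single, crosses_mk]
    by_cases ha : a ∈ A <;> by_cases hb : b ∈ A <;> simp [ha, hb, h2]

/-- An even set crosses every cut an even number of times: sum its boundary over `A`. -/
theorem exists_ne_crosses {φ : E → Sym2 V} {C : Set E} (hC : C ∈ evenSpace φ) {A : Set V} {e : E}
    (he : e ∈ C) (heA : Crosses A (φ e)) : ∃ e' ∈ C, e' ≠ e ∧ Crosses A (φ e') := by
  classical
  by_contra! h
  have h1 : sumOver A (∑ᶠ e ∈ C, bd (φ e)) = 0 := by rw [hC.2, map_zero]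
  rw [AddMonoidHom.map_finsum_mem _ _ hC.1, finsum_eq_single _ e, finsum_eq_if, if_pos he,
    sumOver_bd, if_pos heA] at h1
  · exact one_ne_zero h1
  · intro e' hne
    rw [finsum_eq_if]
    split_ifs with he'
    · rw [sumOver_bd, if_neg (h e' he' hne)]
    · rfl

theorem Walk.sum_bd {G : SimpleGraph V} {u v : V} (p : G.Walk u v) :
    (p.edges.map bd).sum = Finsupp.single u 1 + Finsupp.single v 1 := by
  induction p with
  | nil => simp [add_self_finsupp]
  | @cons u v w h p ih =>
    rw [SimpleGraph.Walk.edges_cons, List.map_cons, List.sum_cons, ih, bd_mk, add_assoc,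
      ← add_assoc (Finsupp.single v 1), add_self_finsupp, zero_add]

/-- A path carries no nonempty even set: its first edge is the only one at its first vertex, so it
is not used, and induction applies to the rest. -/
theorem walk_edges_eq_empty {G : SimpleGraph V} {u v : V} (p : G.Walk u v) (hp : p.IsPath)
    {D : Set (Sym2 V)} (hD : D ∈ evenSpace id) (hDp : ∀ s ∈ D, s ∈ p.edges) : D = ∅ := by
  induction p with
  | nil => exact Set.eq_empty_of_forall_notMem fun s hs => by simpa using hDp s hs
  | @cons u v w h p ih =>
    rw [SimpleGraph.Walk.cons_isPath_iff] at hp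
    have hu : ∀ s ∈ D, s ≠ s(u, v) → ¬ Crosses {u} s := by
      rintro s hs hne ⟨x, hx, y, hy, rfl⟩
      have h1 := hDp _ hs
      rw [SimpleGraph.Walk.edges_cons, List.mem_cons] at h1
      rw [Set.mem_singleton_iff] at hx
      subst hx
      exact hp.2 (p.fst_mem_support_of_mem_edges (h1.resolve_left hne))
    refine ih hp.1 fun s hs => ?_
    have h1 := hDp _ hs
    rw [SimpleGraph.Walk.edges_cons, List.mem_cons] at h1
    refine h1.resolve_left ?_
    rintro rfl
    obtain ⟨s', hs', hne, hc⟩ := exists_ne_crosses hD (A := {u}) hs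
      (crosses_mk.2 (by simp [h.ne']))
    exact hu s' hs' hne hc

theorem image_val_mem_evenSpace {G : SimpleGraph V} {C : Set G.edgeSet} :
    (Subtype.val '' C) ∈ evenSpace (id : Sym2 V → Sym2 V) ↔
      C ∈ evenSpace (Subtype.val : G.edgeSet → Sym2 V) := by
  unfold evenSpace
  simp only [Set.mem_ofPred_eq, id]
  rw [finsum_mem_image Subtype.val_injective.injOn,
    Set.finite_image_iff Subtype.val_injective.injOn]

theorem edges_mem_evenSpace {G : SimpleGraph V} {v : V} {p : G.Walk v v} (hp : p.IsTrail) :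
    {s | s ∈ p.edges} ∈ evenSpace (id : Sym2 V → Sym2 V) := by
  classical
  have : {s | s ∈ p.edges} = ↑p.edges.toFinset := by ext; simp
  rw [this]
  refine ⟨Finset.finite_toSet _, ?_⟩
  rw [finsum_mem_coe_finset, List.sum_toFinset _ hp.edges_nodup]
  exact (Walk.sum_bd p).trans (add_self_finsupp _)

theorem isCircuit_mem_evenSpace {G : SimpleGraph V} {C : Set G.edgeSet} (hC : IsCircuit G C) :
    C ∈ evenSpace (Subtype.val : G.edgeSet → Sym2 V) := by
  obtain ⟨v, p, hp, hpC⟩ := hC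
  rw [← image_val_mem_evenSpace]
  convert edges_mem_evenSpace hp.isTrail using 1
  ext s
  simp only [Set.mem_image, Set.mem_ofPred_eq]
  constructor
  · rintro ⟨e, he, rfl⟩
    exact (hpC e).1 he
  · intro hs
    exact ⟨⟨s, p.edges_subset_edgeSet hs⟩, (hpC _).2 hs, rfl⟩

/-- An edge of an even set is not a bridge of the subgraph formed by that set, since it would be the
only edge crossing a cut. So it lies on a cycle there. -/
theorem exists_isCircuit_subset {G : SimpleGraph V} {C : Set G.edgeSet}
    (hC : C ∈ evenSpace (Subtype.val : G.edgeSet → Sym2 V)) (hne : C.Nonempty) :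
    ∃ D ⊆ C, IsCircuit G D := by
  obtain ⟨⟨e, he⟩, heC⟩ := hne
  induction e with
  | _ x y =>
  set G' := SimpleGraph.fromEdgeSet (Subtype.val '' C) with hG'
  have hle : G' ≤ G := by
    intro a b hab
    rw [hG', SimpleGraph.fromEdgeSet_adj] at hab
    obtain ⟨⟨d, hd, hd'⟩, -⟩ := hab
    rw [← SimpleGraph.mem_edgeSet, ← hd']
    exact d.2
  have hxy : G'.Adj x y := by
    rw [hG', SimpleGraph.fromEdgeSet_adj]
    exact ⟨⟨_, heC, rfl⟩, SimpleGraph.Adj.ne he⟩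
  have hreach : (G'.deleteEdges {s(x, y)}).Reachable x y := by
    by_contra hcon
    obtain ⟨e', he', hne', a, ha, b, hb, hab⟩ := exists_ne_crosses hC
      (A := {z | (G'.deleteEdges {s(x, y)}).Reachable x z}) heC
      (crosses_mk.2 (by simp [hcon]))
    apply hb
    refine SimpleGraph.Reachable.trans ha (SimpleGraph.Adj.reachable ?_)
    rw [SimpleGraph.deleteEdges_adj, hG', SimpleGraph.fromEdgeSet_adj]
    refine ⟨⟨⟨e', he', hab⟩, fun h => ?_⟩, fun h => hne' (Subtype.ext (hab.trans h))⟩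
    subst h
    exact hb ha
  obtain ⟨u, p, hp, -⟩ := SimpleGraph.adj_and_reachable_delete_edges_iff_exists_cycle.1
    ⟨hxy, hreach⟩
  refine ⟨{d | (d : Sym2 V) ∈ (p.mapLe hle).edges}, ?_, u, p.mapLe hle, hp.mapLe hle,
    fun _ => Iff.rfl⟩
  intro d hd
  simp only [Set.mem_ofPred_eq, SimpleGraph.Walk.edges_mapLe_eq_edges] at hd
  have := p.edges_subset_edgeSet hd
  rw [hG', SimpleGraph.edgeSet_fromEdgeSet] at this
  obtain ⟨d', hd', h⟩ := this.1
  rwa [← Subtype.ext h]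

theorem isCircuit_iff {G : SimpleGraph V} {C : Set G.edgeSet} :
    IsCircuit G C ↔ IsMinimalMember (evenSpace (Subtype.val : G.edgeSet → Sym2 V)) C := by
  classical
  constructor
  · intro hC
    refine ⟨isCircuit_mem_evenSpace hC, ?_, ?_⟩
    · obtain ⟨v, p, hp, hpC⟩ := hC
      cases p with
      | nil => exact absurd hp SimpleGraph.Walk.not_isCycle_nil
      | @cons _ w _ h p => exact ⟨⟨s(v, w), h⟩, (hpC _).2 (by simp)⟩
    · intro D hD hDC hne
      have hCe := isCircuit_mem_evenSpace hC
      obtain ⟨v, p, hp, hpC⟩ := hC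
      cases p with
      | nil => exact absurd hp SimpleGraph.Walk.not_isCycle_nil
      | @cons _ w _ h p =>
        rw [SimpleGraph.Walk.cons_isCycle_iff] at hp
        -- A cycle is an edge plus a path. Of `D` and its sum with `C`, one misses that edge, so it
        -- lies in the path and is empty.
        have key : ∀ B ⊆ C, B ∈ evenSpace (Subtype.val : G.edgeSet → Sym2 V) →
            (⟨s(v, w), h⟩ : G.edgeSet) ∉ B → B = ∅ := by
          intro B hBC hB hn
          have := walk_edges_eq_empty p hp.1 (image_val_mem_evenSpace.2 hB) (by
            rintro _ ⟨d, hd, rfl⟩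
            have h1 := (hpC d).1 (hBC hd)
            rw [SimpleGraph.Walk.edges_cons, List.mem_cons] at h1
            refine h1.resolve_left fun h2 => hn ?_
            rwa [← show d = ⟨s(v, w), h⟩ from Subtype.ext h2])
          exact Set.image_eq_empty.1 this
        by_cases hn : (⟨s(v, w), h⟩ : G.edgeSet) ∈ D
        · have h1 := key (symmDiff D C) (by
            rintro x (⟨hx, -⟩ | ⟨hx, -⟩)
            · exact hDC hx
            · exact hx) ((isBinarySpace_evenSpace _).symmDiff_mem _ hD _ hCe) (by
            rintro (⟨-, h2⟩ | ⟨-, h2⟩)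
            · exact h2 (hDC hn)
            · exact h2 hn)
          exact symmDiff_eq_bot.1 h1
        · exact absurd (key D hDC hD hn) hne.ne_empty
  · intro hC
    obtain ⟨D, hDC, hD⟩ := exists_isCircuit_subset hC.1 hC.2.1
    have hDne : D.Nonempty := by
      obtain ⟨v, p, hp, hpC⟩ := hD
      cases p with
      | nil => exact absurd hp SimpleGraph.Walk.not_isCycle_nil
      | @cons _ w _ h p => exact ⟨⟨s(v, w), h⟩, (hpC _).2 (by simp)⟩
    rwa [← hC.2.2 D (isCircuit_mem_evenSpace hD) hDC hDne]

theorem mem_evenSpace_image {φ : E → Sym2 V} {ψ : F → Sym2 V} (k : E ≃ F)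
    (h : ∀ e, ψ (k e) = φ e) {C : Set E} : k '' C ∈ evenSpace ψ ↔ C ∈ evenSpace φ := by
  unfold evenSpace
  simp only [Set.mem_ofPred_eq]
  rw [finsum_mem_image k.injective.injOn, Set.finite_image_iff k.injective.injOn]
  simp only [h]

theorem IsMinimalMember.image_equiv {M : Set (Set E)} {N : Set (Set F)} (k : E ≃ F)
    (h : ∀ C, k '' C ∈ N ↔ C ∈ M) {C : Set E} : IsMinimalMember N (k '' C) ↔ IsMinimalMember M C := by
  constructor
  · rintro ⟨h1, h2, h3⟩
    refine ⟨(h C).1 h1, Set.image_nonempty.1 h2, fun D hD hDC hne => ?_⟩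
    exact k.injective.image_injective
      (h3 _ ((h D).2 hD) (Set.image_mono hDC) (hne.image k))
  · rintro ⟨h1, h2, h3⟩
    refine ⟨(h C).2 h1, h2.image k, fun D hD hDC hne => ?_⟩
    rw [← Equiv.image_symm_image k D] at hD hDC hne ⊢
    rw [h3 _ ((h _).1 hD) ((Set.image_subset_image_iff k.injective).1 hDC)
      (Set.image_nonempty.1 hne)]

/-- Circuits of a simple graph whose edges are enumerated by `k`. -/
theorem isCircuit_image_iff {G : SimpleGraph V} (k : E ≃ G.edgeSet) {φ : E → Sym2 V}
    (h : ∀ e, (k e : Sym2 V) = φ e) {C : Set E} :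
    IsCircuit G (k '' C) ↔ IsMinimalMember (evenSpace φ) C := by
  rw [isCircuit_iff]
  exact IsMinimalMember.image_equiv k fun _ => mem_evenSpace_image k h

end Even

/-! ### Any two edges of a 2-connected graph lie on a common circuit. -/

section TwoConnected

variable {V : Type*} {G : SimpleGraph V}

theorem TwoConnected.exists_third (hG : TwoConnected G) (u v : V) : ∃ w, w ≠ u ∧ w ≠ v := by
  by_contra! h
  have : (Set.univ : Set V) ⊆ {u, v} := fun w _ => by
    by_cases hw : w = u
    · exact Or.inl hw
    · exact Or.inr (h w hw)
  have h1 := (Set.encard_le_encard this).trans (Set.encard_insert_le _ _)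
  rw [Set.encard_univ, Set.encard_singleton] at h1
  have := hG.1.trans h1
  norm_num at this

theorem TwoConnected.exists_path (hG : TwoConnected G) {u v w : V} (hv : v ≠ u) (hw : w ≠ u) :
    ∃ p : G.Walk v w, p.IsPath ∧ u ∉ p.support := by
  have key : ∀ a b : ({u}ᶜ : Set V), ∃ p : G.Walk a b, p.IsPath ∧ u ∉ p.support := by
    intro a b
    obtain ⟨p, hp⟩ := ((hG.2 u).preconnected a b).exists_isPath
    refine ⟨p.map (SimpleGraph.Embedding.induce _).toHom, hp.map Subtype.val_injective, ?_⟩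
    intro h
    obtain ⟨x, -, hx⟩ := List.mem_map.1
      (Eq.mp (congrArg (u ∈ ·) (SimpleGraph.Walk.support_map _ p)) h)
    exact x.2 hx
  exact key ⟨v, hv⟩ ⟨w, hw⟩

theorem TwoConnected.preconnected (hG : TwoConnected G) : G.Preconnected := by
  intro u v
  obtain ⟨w, hwu, hwv⟩ := hG.exists_third u v
  obtain ⟨p, -⟩ := hG.exists_path hwu.symm hwv.symm
  exact ⟨p⟩

/-- A path from `v` to `w` avoiding `u` closes up through `u`. Edges further apart are then linked
by transitivity along a walk. -/
theorem TwoConnected.linked_of_adj (hG : TwoConnected G) {u v w : V} (hv : G.Adj u v)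
    (hw : G.Adj u w) (hvw : v ≠ w) :
    Linked (evenSpace (Subtype.val : G.edgeSet → Sym2 V)) ⟨s(u, v), hv⟩ ⟨s(u, w), hw⟩ := by
  obtain ⟨p, hp, hu⟩ := hG.exists_path hv.ne' hw.ne'
  have hcyc : (SimpleGraph.Walk.cons hv (p.concat hw.symm)).IsCycle := by
    rw [SimpleGraph.Walk.cons_isCycle_iff]
    refine ⟨hp.concat hu _, ?_⟩
    rw [SimpleGraph.Walk.edges_concat, List.concat_eq_append, List.mem_append, List.mem_singleton]
    rintro (h | h)
    · exact hu (p.fst_mem_support_of_mem_edges h)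
    · rcases Sym2.eq_iff.1 h with ⟨rfl, -⟩ | ⟨-, h⟩
      · exact hw.ne rfl
      · exact hvw h
  refine ⟨{e | (e : Sym2 V) ∈ (SimpleGraph.Walk.cons hv (p.concat hw.symm)).edges},
    isCircuit_iff.1 ⟨u, _, hcyc, fun _ => Iff.rfl⟩, ?_, ?_⟩
  · simp
  · simp [SimpleGraph.Walk.edges_concat, Sym2.eq_swap]

theorem TwoConnected.linked_self (hG : TwoConnected G) {u v : V} (hv : G.Adj u v) :
    Linked (evenSpace (Subtype.val : G.edgeSet → Sym2 V)) ⟨s(u, v), hv⟩ ⟨s(u, v), hv⟩ := by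
  obtain ⟨w, hwu, hwv⟩ := hG.exists_third u v
  obtain ⟨p, hp, hu⟩ := hG.exists_path hv.ne' hwu
  cases p with
  | nil => exact absurd rfl hwv
  | @cons _ x _ h p =>
    have hx : x ≠ u := by
      rintro rfl
      exact hu (by simp)
    obtain ⟨C, hC, h1, -⟩ := hG.linked_of_adj hv.symm h hx.symm
    have : (⟨s(u, v), hv⟩ : G.edgeSet) = ⟨s(v, u), hv.symm⟩ := Subtype.ext Sym2.eq_swap
    rw [this]
    exact ⟨C, hC, h1, h1⟩

theorem TwoConnected.linked (hG : TwoConnected G) (e e' : G.edgeSet) :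
    Linked (evenSpace (Subtype.val : G.edgeSet → Sym2 V)) e e' := by
  have hM := isBinarySpace_evenSpace (Subtype.val : G.edgeSet → Sym2 V)
  have hadj : ∀ {u v w : V} (hv : G.Adj u v) (hw : G.Adj u w),
      Linked (evenSpace (Subtype.val : G.edgeSet → Sym2 V)) ⟨s(u, v), hv⟩ ⟨s(u, w), hw⟩ := by
    intro u v w hv hw
    by_cases hvw : v = w
    · subst hvw
      exact hG.linked_self hv
    · exact hG.linked_of_adj hv hw hvw
  have hwalk : ∀ {x y : V} (p : G.Walk x y) {a b : V} (ha : G.Adj x a) (hb : G.Adj y b),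
      Linked (evenSpace (Subtype.val : G.edgeSet → Sym2 V)) ⟨s(x, a), ha⟩ ⟨s(y, b), hb⟩ := by
    intro x y p
    induction p with
    | nil => exact fun ha hb => hadj ha hb
    | @cons x z y h p ih =>
      intro a b ha hb
      refine Linked.trans hM (hadj ha h) ?_
      have : (⟨s(x, z), h⟩ : G.edgeSet) = ⟨s(z, x), h.symm⟩ := Subtype.ext Sym2.eq_swap
      rw [this]
      exact ih h.symm hb
  obtain ⟨e, he⟩ := e
  obtain ⟨e', he'⟩ := e'
  induction e with
  | _ x a =>
  induction e' with
  | _ y b =>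
  obtain ⟨p⟩ := hG.preconnected x y
  exact hwalk p he he'

end TwoConnected
-- Contraction of a set of edges and its kernel on vertex sums.
section Contracted

variable {V W E F : Type*} (φ : E → Sym2 V)

/-- The vertices of the graph after contraction of the edges in `S`. -/
def Contracted (S : Set E) : Type _ := Quot fun u v : V => ∃ g ∈ S, φ g = s(u, v)

/-- The projection of a vertex to the contracted graph. -/
def toContracted (S : Set E) (v : V) : Contracted φ S := Quot.mk _ v

variable {φ} in
theorem toContracted_eq {S : Set E} {g : E} {u v : V} (hg : g ∈ S) (h : φ g = s(u, v)) :
    toContracted φ S u = toContracted φ S v := Quot.sound ⟨g, hg, h⟩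

/-- The first end of an edge. -/
noncomputable def src (g : E) : V := (Quot.out (φ g)).1

/-- The second end of an edge. -/
noncomputable def tgt (g : E) : V := (Quot.out (φ g)).2

theorem mk_src_tgt (g : E) : s(src φ g, tgt φ g) = φ g := Quot.out_eq (φ g)

theorem map_finsum_eq {ψ : E → Sym2 W} {c : V → W} {C : Set E} (hC : C.Finite)
    (h : ∀ g ∈ C, (φ g).map c = ψ g) :
    Finsupp.mapDomain c (∑ᶠ g ∈ C, bd (φ g)) = ∑ᶠ g ∈ C, bd (ψ g) := by
  rw [← Finsupp.mapDomain.addMonoidHom_apply, AddMonoidHom.map_finsum_mem _ _ hC]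
  refine finsum_mem_congr rfl fun g hg => ?_
  rw [Finsupp.mapDomain.addMonoidHom_apply, mapDomain_bd, h g hg]

/-- Sets of edges that are unions of fibres. -/
def Saturated (f : E → F) (C : Set E) : Prop := ∀ g ∈ C, ∀ g', f g = f g' → g' ∈ C

theorem Saturated.preimage_image {C : Set E} (hC : Saturated f C) : f ⁻¹' (f '' C) = C :=
  Set.Subset.antisymm (fun _ ⟨_, hg, h⟩ => hC _ hg _ h) (Set.subset_preimage_image f C)

variable {φ}

theorem exists_finsum_of_eqvGen {S : Set E} {u v : V}
    (h : toContracted φ S u = toContracted φ S v) :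
    ∃ t ⊆ S, t.Finite ∧ Finsupp.single u 1 + Finsupp.single v 1 = ∑ᶠ g ∈ t, bd (φ g) := by
  replace h := Quot.eqvGen_exact h
  induction h with
  | rel u v h =>
    obtain ⟨g, hg, hgu⟩ := h
    exact ⟨{g}, by simpa using hg, Set.finite_singleton _, by
      rw [finsum_mem_singleton, hgu, bd_mk]⟩
  | refl u => exact ⟨∅, by simp, Set.finite_empty, by simp [add_self_finsupp]⟩
  | symm u v h ih =>
    obtain ⟨t, ht, hfin, hsum⟩ := ih
    exact ⟨t, ht, hfin, by rw [← hsum, add_comm]⟩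
  | trans u v w h h' ih ih' =>
    obtain ⟨t, ht, hfin, hsum⟩ := ih
    obtain ⟨t', ht', hfin', hsum'⟩ := ih'
    refine ⟨symmDiff t t', ?_, ?_, ?_⟩
    · rintro x (⟨hx, -⟩ | ⟨hx, -⟩)
      · exact ht hx
      · exact ht' hx
    · refine (hfin.union hfin').subset ?_
      rintro x (⟨hx, -⟩ | ⟨hx, -⟩)
      · exact Or.inl hx
      · exact Or.inr hx
    · rw [finsum_symmDiff hfin hfin', ← hsum, ← hsum', add_assoc,
        ← add_assoc (Finsupp.single v 1), add_self_finsupp, zero_add]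

/-- Choose a representative in each contracted class. Moving every vertex to its representative
changes a vertex sum by the boundary of a finite subset of `S`, and a sum killed by the contraction
is moved to zero. -/
theorem exists_finsum_of_mapDomain_eq_zero {S : Set E} {x : V →₀ ZMod 2}
    (hx : Finsupp.mapDomain (toContracted φ S) x = 0) :
    ∃ t ⊆ S, t.Finite ∧ x = ∑ᶠ g ∈ t, bd (φ g) := by
  let s : Contracted φ S → V := Quot.out
  have hs : ∀ q, toContracted φ S (s q) = q := Quot.out_eq
  have key : ∀ x : V →₀ ZMod 2, ∃ t ⊆ S, t.Finite ∧
      x + Finsupp.mapDomain s (Finsupp.mapDomain (toContracted φ S) x) = ∑ᶠ g ∈ t, bd (φ g) := by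
    intro x
    induction x using Finsupp.induction_linear with
    | zero => exact ⟨∅, by simp, Set.finite_empty, by simp⟩
    | add x y ih ih' =>
      obtain ⟨t, ht, hfin, hsum⟩ := ih
      obtain ⟨t', ht', hfin', hsum'⟩ := ih'
      refine ⟨symmDiff t t', ?_, ?_, ?_⟩
      · rintro x (⟨hx, -⟩ | ⟨hx, -⟩)
        · exact ht hx
        · exact ht' hx
      · refine (hfin.union hfin').subset ?_
        rintro x (⟨hx, -⟩ | ⟨hx, -⟩)
        · exact Or.inl hx
        · exact Or.inr hx
      · rw [finsum_symmDiff hfin hfin', ← hsum, ← hsum', Finsupp.mapDomain_add,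
          Finsupp.mapDomain_add]
        abel
    | single v b =>
      rw [Finsupp.mapDomain_single, Finsupp.mapDomain_single]
      have hb : b = 0 ∨ b = 1 := by
        fin_cases b
        · exact Or.inl rfl
        · exact Or.inr rfl
      rcases hb with rfl | rfl
      · exact ⟨∅, by simp, Set.finite_empty, by simp⟩
      · exact exists_finsum_of_eqvGen (hs _).symm
  obtain ⟨t, ht, hfin, hsum⟩ := key x
  rw [hx, Finsupp.mapDomain_zero, add_zero] at hsum
  exact ⟨t, ht, hfin, hsum⟩

end Contracted

/-! ### Leading edges, the contraction onto them, and the transfer of even sets. -/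

section Fibres

variable {V W E F : Type*} [LinearOrder E] [WellFoundedLT E] (φ : E → Sym2 V) (f : E → F)

/-- The least edge with the same image. -/
noncomputable def lead (g : E) : E :=
  WellFounded.min (wellFounded_lt (α := E)) {g' | f g' = f g} ⟨g, rfl⟩

variable {f}

variable (f) in
theorem apply_lead (g : E) : f (lead f g) = f g :=
  WellFounded.min_mem (wellFounded_lt (α := E)) {g' | f g' = f g} ⟨g, rfl⟩

theorem lead_le_of_eq {g g' : E} (h : f g' = f g) : lead f g ≤ g' :=
  not_lt.1 (WellFounded.not_lt_min (wellFounded_lt (α := E)) {g' | f g' = f g} h)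

theorem lead_le (g : E) : lead f g ≤ g := lead_le_of_eq rfl

theorem lead_congr {g g' : E} (h : f g = f g') : lead f g = lead f g' :=
  le_antisymm (lead_le_of_eq ((apply_lead f g').trans h.symm))
    (lead_le_of_eq ((apply_lead f g).trans h))

theorem lead_lead (g : E) : lead f (lead f g) = lead f g := lead_congr (apply_lead f g)

variable (f)

/-- The edges that are not the least of their fibre. -/
def tails : Set E := {g | lead f g ≠ g}

/-- The edges of `S` after `g` in the fibre of `g`. -/
def later (S : Set E) (g : E) : Set E := {g' | g' ∈ S ∧ g < g' ∧ f g' = f g}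

/-- The edge of `S` right after `g` in the fibre of `g`. -/
noncomputable def next (S : Set E) (g : E) (h : (later f S g).Nonempty) : E :=
  WellFounded.min (wellFounded_lt (α := E)) (later f S g) h

variable {f}

theorem lead_notMem_tails (g : E) : lead f g ∉ tails f := fun h => h (lead_lead g)

theorem mem_tails_of_lt {g g' : E} (h : g < g') (hf : f g = f g') : g' ∈ tails f :=
  ((lead_le_of_eq hf).trans_lt h).ne

theorem next_mem {S : Set E} {g : E} (h : (later f S g).Nonempty) :
    next f S g h ∈ later f S g :=
  WellFounded.min_mem (wellFounded_lt (α := E)) _ h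

theorem next_le {S : Set E} {g g' : E} (h : (later f S g).Nonempty) (hg : g' ∈ later f S g) :
    next f S g h ≤ g' :=
  not_lt.1 (WellFounded.not_lt_min (wellFounded_lt (α := E)) _ hg)

theorem next_eq_of_forall_le {S : Set E} {g g' : E} (h : (later f S g).Nonempty)
    (hg : g' ∈ later f S g) (hle : ∀ x ∈ later f S g, g' ≤ x) : next f S g h = g' :=
  le_antisymm (next_le h hg) (hle _ (next_mem h))

variable (f)

open Classical in
/-- The first end of an edge after contracting `S` and inserting its edges in the fibres. -/
noncomputable def start (S : Set E) (g : E) : Contracted φ S ⊕ S :=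
  if h : g ∈ S then Sum.inr ⟨g, h⟩ else Sum.inl (toContracted φ S (src φ g))

open Classical in
/-- The second end of an edge after contracting `S` and inserting its edges in the fibres. -/
noncomputable def finish (S : Set E) (g : E) : Contracted φ S ⊕ S :=
  if h : (g ∈ S ∨ lead f g = g) ∧ (later f S g).Nonempty then
    Sum.inr ⟨next f S g h.2, (next_mem h.2).1⟩
  else Sum.inl (toContracted φ S (tgt φ (if g ∈ S then lead f g else g)))

/-- The graph in which the edges in `S` are contracted and then inserted again as subdivisions,
in order, of the leading edges of their fibres. -/
noncomputable def regroup (S : Set E) (g : E) : Sym2 (Contracted φ S ⊕ S) :=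
  s(start φ S g, finish φ f S g)

/-- The graph obtained by contracting all but the leading edges of the fibres. -/
noncomputable def contraction (hf : Function.Surjective f) (d : F) :
    Sym2 (Contracted φ (tails f)) :=
  (φ (lead f (Function.surjInv hf d))).map (toContracted φ (tails f))

variable {f}

theorem contraction_apply (hf : Function.Surjective f) (g : E) :
    contraction φ f hf (f g) = (φ (lead f g)).map (toContracted φ (tails f)) := by
  rw [contraction, lead_congr (Function.surjInv_eq hf (f g))]

theorem injOn_leads (C : Set E) : Set.InjOn f {g ∈ C | lead f g = g} := by
  rintro g ⟨-, hg⟩ g' ⟨-, hg'⟩ h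
  rw [← hg, ← hg', lead_congr h]

theorem Saturated.image_leads {C : Set E} (hC : Saturated f C) :
    f '' {g ∈ C | lead f g = g} = f '' C := by
  refine Set.Subset.antisymm (Set.image_mono fun g hg => hg.1) ?_
  rintro _ ⟨g, hg, rfl⟩
  exact ⟨lead f g, ⟨hC g hg _ (apply_lead f g).symm, lead_lead g⟩, apply_lead f g⟩

variable {φ}

/-- The map `c` kills the boundaries of the non-leading edges, and a saturated set has exactly one
leading edge over each point of its image. This serves both for the original graph and for the
regrouped one. -/
theorem image_mem_evenSpace {ψ : F → Sym2 W} {c : V → W}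
    (hlead : ∀ g, lead f g = g → (φ g).map c = ψ (f g))
    (htail : ∀ g ∈ tails f, bd ((φ g).map c) = 0) {C : Set E} (hC : C ∈ evenSpace φ)
    (hsat : Saturated f C) : f '' C ∈ evenSpace ψ := by
  refine ⟨hC.1.image f, ?_⟩
  have hfin : {g ∈ C | lead f g = g}.Finite := hC.1.subset fun g hg => hg.1
  have h0 := map_finsum_eq φ (c := c) (ψ := fun g => (φ g).map c) hC.1 fun _ _ => rfl
  rw [hC.2, Finsupp.mapDomain_zero, ← finsum_mem_inter_add_sdiff {g | lead f g = g} hC.1] at h0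
  have h1 : ∑ᶠ g ∈ C \ {g | lead f g = g}, bd ((φ g).map c) = 0 :=
    finsum_mem_of_eqOn_zero fun g hg => htail g hg.2
  rw [h1, add_zero] at h0
  rw [← hsat.image_leads, finsum_mem_image (injOn_leads C), h0]
  exact finsum_mem_congr rfl fun g hg => by rw [hlead g hg.2]

theorem image_mem_evenSpace_contraction (hf : Function.Surjective f) {C : Set E}
    (hC : C ∈ evenSpace φ) (hsat : Saturated f C) : f '' C ∈ evenSpace (contraction φ f hf) := by
  refine image_mem_evenSpace (c := toContracted φ (tails f)) ?_ ?_ hC hsat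
  · intro g hg
    rw [contraction_apply, hg]
  · intro g hg
    rw [← mk_src_tgt φ g, Sym2.map_mk, toContracted_eq hg (mk_src_tgt φ g).symm, bd_diag]

/-- The leading edges over `D` have a boundary killed by the contraction, so finitely many
non-leading edges complete them to an even set. Being saturated, that set can only be `f ⁻¹' D`. -/
theorem preimage_mem_evenSpace (hf : Function.Surjective f)
    (hsat : ∀ C ∈ evenSpace φ, Saturated f C) {D : Set F}
    (hD : D ∈ evenSpace (contraction φ f hf)) : f ⁻¹' D ∈ evenSpace φ := by
  set C₀ : Set E := {g ∈ f ⁻¹' D | lead f g = g} with hC₀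
  have him : f '' C₀ = D := by
    have : Saturated f (f ⁻¹' D) := fun g hg g' h => by
      rw [Set.mem_preimage, ← h]; exact hg
    rw [hC₀, this.image_leads, Set.image_preimage_eq _ hf]
  have hinj : Set.InjOn f C₀ := injOn_leads _
  have hfin : C₀.Finite := Set.Finite.of_finite_image (him ▸ hD.1) hinj
  have h0 : Finsupp.mapDomain (toContracted φ (tails f)) (∑ᶠ g ∈ C₀, bd (φ g)) = 0 := by
    rw [map_finsum_eq φ (ψ := fun g => contraction φ f hf (f g)) hfin fun g hg => by
      rw [contraction_apply, hg.2], ← finsum_mem_image (f := fun d => bd (contraction φ f hf d))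
      hinj, him, hD.2]
  obtain ⟨t, ht, htfin, hsum⟩ := exists_finsum_of_mapDomain_eq_zero h0
  have hmem : symmDiff C₀ t ∈ evenSpace φ := by
    refine ⟨(hfin.union htfin).subset ?_, ?_⟩
    · rintro x (⟨hx, -⟩ | ⟨hx, -⟩)
      · exact Or.inl hx
      · exact Or.inr hx
    · rw [finsum_symmDiff hfin htfin, hsum, add_self_finsupp]
  have hs := hsat _ hmem
  convert hmem using 1
  ext g
  have hlt : lead f g ∉ t := fun h => lead_notMem_tails g (ht h)
  constructor
  · intro hg
    refine hs (lead f g) (Or.inl ⟨⟨?_, lead_lead g⟩, hlt⟩) g (apply_lead f g)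
    rwa [Set.mem_preimage, apply_lead f]
  · intro hg
    have := hs g hg (lead f g) (apply_lead f g).symm
    rcases this with h | h
    · have := h.1.1
      rwa [Set.mem_preimage, apply_lead f] at this
    · exact absurd h.1 hlt

end Fibres

section Start

variable {V E : Type*} {φ : E → Sym2 V}

theorem start_of_mem {S : Set E} {g : E} (h : g ∈ S) : start φ S g = Sum.inr ⟨g, h⟩ := dif_pos h

theorem start_of_notMem {S : Set E} {g : E} (h : g ∉ S) :
    start φ S g = Sum.inl (toContracted φ S (src φ g)) := dif_neg h

theorem start_eq_inr {S : Set E} {g : E} {x : S} : start φ S g = Sum.inr x ↔ g = x := by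
  by_cases h : g ∈ S
  · rw [start_of_mem h, Sum.inr.injEq]
    exact ⟨fun h => congrArg Subtype.val h, fun h => Subtype.ext h⟩
  · rw [start_of_notMem h]
    refine ⟨fun h => (nomatch h), ?_⟩
    rintro rfl
    exact absurd x.2 h

end Start

theorem fibre_finite_later {E F : Type*} [LinearOrder E] {f : E → F}
    (hfin : ∀ d, (f ⁻¹' {d}).Finite) (S : Set E) (g : E) :
    (later f S g).Finite := (hfin (f g)).subset fun _ h => h.2.2

/-! ### The regrouped graph has the same even sets as the original one. -/

section Regroup

variable {V W E F : Type*} [LinearOrder E] [WellFoundedLT E] {φ : E → Sym2 V} {f : E → F}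

theorem later_tails (g : E) : later f (tails f) g = {g' | g < g' ∧ f g' = f g} :=
  Set.ext fun _ => ⟨fun h => h.2, fun h => ⟨mem_tails_of_lt h.1 h.2.symm, h⟩⟩

theorem apply_next {S : Set E} {g : E} (h : (later f S g).Nonempty) : f (next f S g h) = f g :=
  (next_mem h).2.2

theorem lt_next {S : Set E} {g : E} (h : (later f S g).Nonempty) : g < next f S g h :=
  (next_mem h).2.1

theorem later_next {S : Set E} {g : E} (h : (later f S g).Nonempty) :
    later f S g = insert (next f S g h) (later f S (next f S g h)) := by
  ext x
  constructor
  · intro hx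
    rcases (next_le h hx).eq_or_lt with h1 | h1
    · exact Or.inl h1.symm
    · exact Or.inr ⟨hx.1, h1, hx.2.2.trans (apply_next h).symm⟩
  · rintro (rfl | hx)
    · exact next_mem h
    · exact ⟨hx.1, (lt_next h).trans hx.2.1, hx.2.2.trans (apply_next h)⟩

/-- Downward induction along a finite fibre. -/
theorem fibre_induction {S : Set E} (hfin : ∀ g, (later f S g).Finite) {P : E → Prop}
    (hlast : ∀ g, ¬ (later f S g).Nonempty → P g)
    (hstep : ∀ g (h : (later f S g).Nonempty), P (next f S g h) → P g) (g : E) : P g := by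
  induction hn : (later f S g).ncard using Nat.strong_induction_on generalizing g with
  | _ n ih =>
    by_cases h : (later f S g).Nonempty
    · refine hstep g h (ih _ ?_ _ rfl)
      rw [← hn, later_next h]
      have hnot : next f S g h ∉ later f S (next f S g h) := fun hx => lt_irrefl _ hx.2.1
      rw [Set.ncard_insert_of_notMem hnot (hfin _)]
      exact Nat.lt_succ_self _
    · exact hlast g h

theorem finish_of_nonempty {S : Set E} {g : E} (hg : g ∈ S ∨ lead f g = g)
    (h : (later f S g).Nonempty) :
    finish φ f S g = Sum.inr ⟨next f S g h, (next_mem h).1⟩ := dif_pos ⟨hg, h⟩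

theorem finish_of_not_nonempty {S : Set E} {g : E} (hg : g ∈ S ∨ lead f g = g)
    (h : ¬ (later f S g).Nonempty) :
    finish φ f S g = Sum.inl (toContracted φ S (tgt φ (lead f g))) := by
  rw [finish, dif_neg fun h' => h h'.2]
  split_ifs with hS
  · rfl
  · rw [hg.resolve_left hS]

theorem finish_of_notMem {S : Set E} {g : E} (hg : g ∉ S) (hg' : lead f g ≠ g) :
    finish φ f S g = Sum.inl (toContracted φ S (tgt φ g)) := by
  rw [finish, dif_neg fun h' => h'.1.elim hg hg', if_neg hg]

theorem finish_eq_inr {S : Set E} {g : E} {x : S} (h : finish φ f S g = Sum.inr x) :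
    ∃ h : (later f S g).Nonempty, next f S g h = x := by
  unfold finish at h
  split_ifs at h with hg
  exact ⟨hg.2, congrArg Subtype.val (Sum.inr.inj h)⟩

theorem next_injective {S : Set E} {g g' : E} (h : (later f S g).Nonempty)
    (h' : (later f S g').Nonempty) (hg : g ∈ S ∨ lead f g = g) (hg' : g' ∈ S ∨ lead f g' = g')
    (heq : next f S g h = next f S g' h') : g = g' := by
  have hfg : f g = f g' := by rw [← apply_next h, ← apply_next h', heq]
  have aux : ∀ {a b : E} (ha : (later f S a).Nonempty) (hb : (later f S b).Nonempty),
      (b ∈ S ∨ lead f b = b) → f a = f b → next f S a ha = next f S b hb → ¬ a < b := by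
    intro a b ha hb hbS hab heq hlt
    have hbl : b ∈ later f S a := by
      refine ⟨hbS.resolve_right fun hlead => ?_, hlt, hab.symm⟩
      exact absurd (hlead ▸ lead_le_of_eq hab) (not_le.2 hlt)
    have h1 := next_le ha hbl
    rw [heq] at h1
    exact absurd (lt_next hb) (not_lt.2 h1)
  exact le_antisymm (not_lt.1 (aux h' h hg hfg.symm heq.symm)) (not_lt.1 (aux h h' hg' hfg heq))

theorem mem_tails_or (g : E) : g ∈ tails f ∨ lead f g = g := by
  by_cases h : lead f g = g
  · exact Or.inr h
  · exact Or.inl h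

/-- The last vertex of the chain replacing the leading edge of the fibre of `g`. -/
noncomputable def chainEnd (φ : E → Sym2 V) (f : E → F) (g : E) :
    Contracted φ (tails f) ⊕ tails f :=
  Sum.inl (toContracted φ (tails f) (tgt φ (lead f g)))

theorem chainEnd_congr {g g' : E} (h : f g = f g') : chainEnd φ f g = chainEnd φ f g' := by
  rw [chainEnd, chainEnd, lead_congr h]

theorem regroup_of_nonempty {g : E} (h : (later f (tails f) g).Nonempty) :
    regroup φ f (tails f) g = s(start φ (tails f) g, start φ (tails f) (next f (tails f) g h)) := by
  rw [regroup, finish_of_nonempty (mem_tails_or g) h, start_of_mem (next_mem h).1]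

theorem regroup_of_not_nonempty {g : E} (h : ¬ (later f (tails f) g).Nonempty) :
    regroup φ f (tails f) g = s(start φ (tails f) g, chainEnd φ f g) := by
  rw [regroup, finish_of_not_nonempty (mem_tails_or g) h]
  rfl

/-- The boundaries telescope along the chain; on a whole fibre they leave the two ends of the
leading edge. -/
theorem finsum_upper (hfin : ∀ d, (f ⁻¹' {d}).Finite) (g : E) :
    ∑ᶠ g' ∈ insert g (later f (tails f) g), bd (regroup φ f (tails f) g') =
      bd s(start φ (tails f) g, chainEnd φ f g) := by
  have hnot : ∀ g : E, g ∉ later f (tails f) g := fun g h => lt_irrefl g h.2.1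
  induction g using fibre_induction (f := f) (S := tails f) (fibre_finite_later hfin _) with
  | hlast g h =>
    rw [Set.not_nonempty_iff_eq_empty.1 h, insert_empty_eq, finsum_mem_singleton,
      regroup_of_not_nonempty h]
  | hstep g h ih =>
    rw [finsum_mem_insert _ (hnot g) (fibre_finite_later hfin _ _), later_next h, ih,
      regroup_of_nonempty h, bd_mk, bd_mk, bd_mk, chainEnd_congr (apply_next h), add_assoc,
      ← add_assoc (Finsupp.single (start φ (tails f) (next f (tails f) g h)) 1),
      add_self_finsupp, zero_add]

theorem insert_lead_later (g : E) :
    insert (lead f g) (later f (tails f) (lead f g)) = f ⁻¹' {f g} := by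
  ext x
  rw [later_tails]
  constructor
  · rintro (rfl | hx)
    · exact apply_lead f g
    · exact hx.2.trans (apply_lead f g)
  · intro hx
    rcases (lead_le_of_eq hx).eq_or_lt with h | h
    · exact Or.inl h.symm
    · exact Or.inr ⟨h, hx.trans (apply_lead f g).symm⟩

theorem finsum_fibre (hfin : ∀ d, (f ⁻¹' {d}).Finite) (hf : Function.Surjective f) (d : F) :
    ∑ᶠ g ∈ f ⁻¹' {d}, bd (regroup φ f (tails f) g) =
      Finsupp.mapDomain Sum.inl (bd (contraction φ f hf d)) := by
  obtain ⟨g, rfl⟩ := hf d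
  rw [← insert_lead_later, finsum_upper hfin, contraction_apply, mapDomain_bd,
    start_of_notMem (lead_notMem_tails g), chainEnd, lead_lead, ← mk_src_tgt φ (lead f g),
    Sym2.map_mk, Sym2.map_mk]

theorem preimage_mem_evenSpace_regroup (hfin : ∀ d, (f ⁻¹' {d}).Finite)
    (hf : Function.Surjective f) {D : Set F} (hD : D ∈ evenSpace (contraction φ f hf)) :
    f ⁻¹' D ∈ evenSpace (regroup φ f (tails f)) := by
  have hU : f ⁻¹' D = ⋃ d ∈ D, f ⁻¹' {d} := by ext; simp
  refine ⟨?_, ?_⟩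
  · rw [hU]
    exact hD.1.biUnion fun d _ => hfin d
  · rw [hU, finsum_mem_biUnion (fun d _ d' _ h => ?_) hD.1 fun d _ => hfin d]
    · simp only [finsum_fibre hfin hf]
      have := AddMonoidHom.map_finsum_mem (fun d => bd (contraction φ f hf d))
        (Finsupp.mapDomain.addMonoidHom (M := ZMod 2) (Sum.inl (β := tails f))) hD.1
      simp only [Finsupp.mapDomain.addMonoidHom_apply] at this
      rw [← this, hD.2, Finsupp.mapDomain_zero]
    · refine Set.disjoint_left.2 fun x hx hx' => h ?_
      rw [Set.mem_preimage, Set.mem_singleton_iff] at hx hx'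
      rw [← hx, ← hx']

/-- The edges of the regrouped graph at an inserted vertex. -/
theorem crosses_regroup_iff {x e : E} (hx : x ∈ tails f) :
    Crosses {Sum.inr ⟨x, hx⟩} (regroup φ f (tails f) e) ↔
      e = x ∨ ∃ h : (later f (tails f) e).Nonempty, next f (tails f) e h = x := by
  rw [regroup, crosses_mk, Set.mem_singleton_iff, Set.mem_singleton_iff, start_eq_inr]
  have h2 : finish φ f (tails f) e = Sum.inr ⟨x, hx⟩ ↔
      ∃ h : (later f (tails f) e).Nonempty, next f (tails f) e h = x := by
    refine ⟨fun h => finish_eq_inr h, ?_⟩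
    rintro ⟨h, rfl⟩
    exact finish_of_nonempty (mem_tails_or e) h
  rw [h2]
  have h3 : ¬ (e = x ∧ ∃ h : (later f (tails f) e).Nonempty, next f (tails f) e h = x) := by
    rintro ⟨rfl, h, h'⟩
    exact (lt_next h).ne h'.symm
  tauto

/-- Only `g` and its successor meet the vertex inserted between them, so an even set contains both
or neither. -/
theorem next_mem_iff {C : Set E} (hC : C ∈ evenSpace (regroup φ f (tails f))) {g : E}
    (h : (later f (tails f) g).Nonempty) : next f (tails f) g h ∈ C ↔ g ∈ C := by
  have hx := (next_mem h).1
  have hcross : ∀ e, Crosses {Sum.inr ⟨_, hx⟩} (regroup φ f (tails f) e) ↔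
      e = next f (tails f) g h ∨ e = g := by
    intro e
    rw [crosses_regroup_iff hx]
    refine or_congr_right ⟨?_, ?_⟩
    · rintro ⟨h', he⟩
      exact next_injective h' h (mem_tails_or e) (mem_tails_or g) he
    · rintro rfl
      exact ⟨h, rfl⟩
  constructor
  · intro hmem
    obtain ⟨e, he, hne, hc⟩ := exists_ne_crosses hC hmem ((hcross _).2 (Or.inl rfl))
    rwa [← ((hcross e).1 hc).resolve_left hne]
  · intro hmem
    obtain ⟨e, he, hne, hc⟩ := exists_ne_crosses hC hmem ((hcross _).2 (Or.inr rfl))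
    rwa [← ((hcross e).1 hc).resolve_right hne]

theorem saturated_of_mem_evenSpace_regroup (hfin : ∀ d, (f ⁻¹' {d}).Finite) {C : Set E}
    (hC : C ∈ evenSpace (regroup φ f (tails f))) : Saturated f C := by
  have key : ∀ g : E, ∀ g' ∈ later f (tails f) g, g' ∈ C ↔ g ∈ C := by
    intro g
    induction g using fibre_induction (f := f) (S := tails f) (fibre_finite_later hfin _) with
    | hlast g h => exact fun g' hg' => absurd ⟨g', hg'⟩ h
    | hstep g h ih =>
      intro g' hg'
      rw [later_next h] at hg'
      rw [← next_mem_iff hC h]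
      rcases hg' with rfl | hg'
      · rfl
      · exact ih g' hg'
  have key2 : ∀ g, g ∈ C ↔ lead f g ∈ C := by
    intro g
    have : g ∈ insert (lead f g) (later f (tails f) (lead f g)) := by
      rw [insert_lead_later]; rfl
    rcases this with h | h
    · exact ⟨fun h' => h ▸ h', fun h' => h ▸ h'⟩
    · exact key _ _ h
  intro g hg g' h
  rw [key2, ← lead_congr h, ← key2]
  exact hg

theorem evenSpace_regroup (hfin : ∀ d, (f ⁻¹' {d}).Finite) (hf : Function.Surjective f)
    (hsat : ∀ C ∈ evenSpace φ, Saturated f C) :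
    evenSpace (regroup φ f (tails f)) = evenSpace φ := by
  ext C
  constructor
  · intro hC
    have hs := saturated_of_mem_evenSpace_regroup hfin hC
    rw [← hs.preimage_image]
    refine preimage_mem_evenSpace hf hsat ?_
    -- Sending every inserted vertex to the end of its chain turns the non-leading edges into loops
    -- and the leading edge back into an edge of the contraction.
    have hend : ∀ g : E, Sum.elim id (fun x : tails f => toContracted φ (tails f)
        (tgt φ (lead f (x : E)))) (finish φ f (tails f) g) =
          toContracted φ (tails f) (tgt φ (lead f g)) := by
      intro g
      by_cases h : (later f (tails f) g).Nonempty
      · rw [finish_of_nonempty (mem_tails_or g) h, Sum.elim_inr, lead_congr (apply_next h)]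
      · rw [finish_of_not_nonempty (mem_tails_or g) h]
        rfl
    refine image_mem_evenSpace (c := Sum.elim id fun x : tails f =>
      toContracted φ (tails f) (tgt φ (lead f (x : E)))) ?_ ?_ hC hs
    · intro g hg
      rw [regroup, Sym2.map_mk, hend, contraction_apply, hg,
        start_of_notMem fun h : g ∈ tails f => h hg, Sum.elim_inl, id]
      conv_rhs => rw [← mk_src_tgt φ g, Sym2.map_mk]
    · intro g hg
      rw [regroup, Sym2.map_mk, hend, start_of_mem hg, Sum.elim_inr, bd_diag]
  · intro hC
    rw [← (hsat C hC).preimage_image]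
    exact preimage_mem_evenSpace_regroup hfin hf
      (image_mem_evenSpace_contraction hf hC (hsat C hC))

end Regroup

/-! ### Switchings up to renaming of vertices. -/

section Switching

variable {V W X E : Type*}

theorem sym2_map_congr {f g : V → W} {s : Sym2 V} (h : ∀ x ∈ s, f x = g x) : s.map f = s.map g :=
  Sym2.map_congr h

/-- An edge indexed graph arises from another one by switchings and renaming of vertices. -/
def SwitchEquiv (φ : E → Sym2 V) (ψ : E → Sym2 W) : Prop :=
  ∃ χ : E → Sym2 V, Relation.ReflTransGen Switching φ χ ∧ ∃ σ : V ≃ W, ∀ e, ψ e = (χ e).map σ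

theorem Switching.map {φ ψ : E → Sym2 V} (σ : V ≃ W) (h : Switching φ ψ) :
    Switching (fun e => (φ e).map σ) fun e => (ψ e).map σ := by
  obtain ⟨u, v, A, huv, hA, hψ⟩ := h
  refine ⟨σ u, σ v, A, σ.injective.ne huv, ?_, fun e => ?_⟩
  · rintro w ⟨a, ha, hwa⟩ ⟨b, hb, hwb⟩
    obtain ⟨x, hx, rfl⟩ := Sym2.mem_map.1 hwa
    obtain ⟨y, hy, hxy⟩ := Sym2.mem_map.1 hwb
    obtain rfl := σ.injective hxy
    rcases hA y ⟨a, ha, hx⟩ ⟨b, hb, hy⟩ with rfl | rfl <;> simp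
  · simp only [hψ e]
    split_ifs
    · rw [Sym2.map_map, Sym2.map_map]
      refine sym2_map_congr fun x _ => ?_
      simp only [Function.comp_apply]
      classical
      rw [Equiv.swap_apply_def, Equiv.swap_apply_def]
      simp only [σ.injective.eq_iff]
      split_ifs <;> rfl
    · rfl

theorem SwitchEquiv.trans {φ : E → Sym2 V} {ψ : E → Sym2 W} {χ : E → Sym2 X}
    (h : SwitchEquiv φ ψ) (h' : SwitchEquiv ψ χ) : SwitchEquiv φ χ := by
  obtain ⟨φ', hφ, σ, hσ⟩ := h
  obtain ⟨ψ', hψ, τ, hτ⟩ := h'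
  have hlift : Relation.ReflTransGen Switching (fun e => (ψ e).map σ.symm)
      (fun e => (ψ' e).map σ.symm) :=
    hψ.lift (fun (φ : E → Sym2 W) e => (φ e).map σ.symm) fun _ _ h => Switching.map σ.symm h
  have hback : (fun e => (ψ e).map σ.symm) = φ' := by
    funext e
    rw [hσ e, Sym2.map_map]
    simp
  rw [hback] at hlift
  refine ⟨_, hφ.trans hlift, σ.trans τ, fun e => ?_⟩
  rw [hτ e, Sym2.map_map]
  refine sym2_map_congr fun x _ => ?_
  simp

/-- Contracting one edge `e = xy` of a two-edge cut `{e, l}` and subdividing the other edge `l`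
is achieved by at most two switchings. -/
theorem switchEquiv_of_cut {φ : E → Sym2 V} {ψ : E → Sym2 W} (Y : Set V) {e l : E} {x y m b : V}
    (hx : x ∉ Y) (hy : y ∈ Y) (hm : m ∉ Y) (hb : b ∈ Y) (hel : e ≠ l) (he : φ e = s(x, y))
    (hl : φ l = s(m, b)) (hY : ∀ g, g ≠ e → g ≠ l → (∀ v ∈ φ g, v ∈ Y) ∨ ∀ v ∈ φ g, v ∉ Y)
    (π : V → W) (z : W) (hπ : π x = π y)
    (hinj : ∀ u v, u ≠ y → v ≠ y → π u = π v → u = v)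
    (hz : ∀ w, w ≠ z ↔ ∃ v, π v = w) (hψ : ∀ g, g ≠ e → g ≠ l → ψ g = (φ g).map π)
    (hψl : ψ l = s(π m, z)) (hψe : ψ e = s(z, π b)) : SwitchEquiv φ ψ := by
  classical
  have hxy : x ≠ y := fun h => hx (h ▸ hy)
  have hxb : x ≠ b := fun h => hx (h ▸ hb)
  have hmy : m ≠ y := fun h => hm (h ▸ hy)
  have hmb : m ≠ b := fun h => hm (h ▸ hb)
  let B : Set E := {g | g ≠ e ∧ g ≠ l ∧ ∀ v ∈ φ g, v ∈ Y}
  have heB : e ∉ B := fun h => h.1 rfl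
  have hlB : l ∉ B := fun h => h.2.1 rfl
  have hnotB : ∀ g, g ∉ B → g ≠ e → g ≠ l → ∀ v ∈ φ g, v ∉ Y := fun g hg h1 h2 =>
    (hY g h1 h2).resolve_left fun h => hg ⟨h1, h2, h⟩
  -- After the switchings `b` plays the part of the subdividing vertex `z`. The vertex `y`, made
  -- redundant by the contraction, takes over the place of the old `b` when the two differ.
  let σ₀ : V → W := fun v => if v = b then z else π (Equiv.swap b y v)
  have hπz : ∀ v, π v ≠ z := fun v => (hz _).2 ⟨v, rfl⟩
  have hswap : ∀ v, v ≠ b → Equiv.swap b y v ≠ y := fun v hv h =>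
    hv ((Equiv.swap b y).injective (h.trans (Equiv.swap_apply_left b y).symm))
  have hσinj : Function.Injective σ₀ := by
    intro u v huv
    simp only [σ₀] at huv
    split_ifs at huv with h1 h2 h2
    · rw [h1, h2]
    · exact absurd huv.symm (hπz _)
    · exact absurd huv (hπz _)
    · exact (Equiv.swap b y).injective (hinj _ _ (hswap u h1) (hswap v h2) huv)
  have hσsurj : Function.Surjective σ₀ := by
    intro w
    by_cases hw : w = z
    · exact ⟨b, by simp [σ₀, hw]⟩
    · obtain ⟨v, rfl⟩ : ∃ v, π v = w := (hz w).1 hw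
      obtain ⟨v', hv', hvv⟩ : ∃ v', v' ≠ y ∧ π v' = π v := by
        by_cases hv : v = y
        · exact ⟨x, hxy, hv ▸ hπ⟩
        · exact ⟨v, hv, rfl⟩
      refine ⟨Equiv.swap b y v', ?_⟩
      have : Equiv.swap b y v' ≠ b := fun h =>
        hv' ((Equiv.swap b y).injective (h.trans (Equiv.swap_apply_right b y).symm))
      simp only [σ₀, if_neg this, Equiv.swap_apply_self, hvv]
  let σ : V ≃ W := Equiv.ofBijective σ₀ ⟨hσinj, hσsurj⟩
  have hσ₀ : ∀ v, σ v = if v = b then z else π (Equiv.swap b y v) := fun _ => rfl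
  have hσb : σ b = z := by rw [hσ₀, if_pos rfl]
  have hσ : ∀ v, v ≠ b → v ≠ y → σ v = π v := fun v h1 h2 => by
    rw [hσ₀, if_neg h1, Equiv.swap_apply_of_ne_of_ne h1 h2]
  -- the first switching
  let A : Set E := insert e B
  let φ₁ : E → Sym2 V := fun g => if g ∈ A then (φ g).map (Equiv.swap b x) else φ g
  have h1 : Switching φ φ₁ := by
    refine ⟨b, x, A, hxb.symm, ?_, fun g => by by_cases hg : g ∈ A <;> simp [φ₁, hg]⟩
    rintro w ⟨g, hg, hwg⟩ ⟨g', hg', hwg'⟩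
    have hg'e : g' ≠ e := fun h => hg' (Or.inl h)
    have hg'B : g' ∉ B := fun h => hg' (Or.inr h)
    by_cases hwY : w ∈ Y
    · left
      by_cases hg'l : g' = l
      · rw [hg'l, hl] at hwg'
        rcases Sym2.mem_iff.1 hwg' with rfl | rfl
        · exact absurd hwY hm
        · rfl
      · exact absurd hwY (hnotB g' hg'B hg'e hg'l w hwg')
    · right
      rcases hg with rfl | hg
      · rw [he] at hwg
        rcases Sym2.mem_iff.1 hwg with rfl | rfl
        · rfl
        · exact absurd hy hwY
      · exact absurd (hg.2.2 w hwg) hwY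
  have φ₁e : φ₁ e = s(b, Equiv.swap b x y) := by
    simp only [φ₁, if_pos (show e ∈ A from Or.inl rfl), he, Sym2.map_mk, Equiv.swap_apply_right]
  have hlA : l ∉ A := fun h => h.elim (fun h => hel h.symm) hlB
  have φ₁l : φ₁ l = s(m, b) := by simp only [φ₁, if_neg hlA, hl]
  have φ₁B : ∀ g ∈ B, φ₁ g = (φ g).map (Equiv.swap b x) := fun g hg => by
    simp only [φ₁, if_pos (show g ∈ A from Or.inr hg)]
  have φ₁n : ∀ g, g ≠ e → g ∉ B → φ₁ g = φ g := fun g hge hgB => by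
    simp only [φ₁, if_neg (show g ∉ A from fun h => h.elim hge hgB)]
  have hrest : ∀ g, g ≠ e → g ≠ l → g ∉ B → ψ g = (φ g).map σ := by
    intro g hge hgl hgB
    rw [hψ g hge hgl]
    refine sym2_map_congr fun v hv => (hσ v ?_ ?_).symm
    · rintro rfl
      exact hnotB g hgB hge hgl _ hv hb
    · rintro rfl
      exact hnotB g hgB hge hgl _ hv hy
  -- Now `b` meets only `e` and `l`. If `b = y`, the part `B` is already attached at `x` as
  -- required. Otherwise the former `b` of this part sits at `x` and should be at `y`, while its `y`
  -- should be at `x`; a second switching exchanges them.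
  by_cases hby : b = y
  · subst hby
    refine ⟨φ₁, .single h1, σ, fun g => ?_⟩
    by_cases hge : g = e
    · rw [hge, φ₁e, hψe, Sym2.map_mk, hσb, Equiv.swap_apply_left, hσ x hxb hxy, hπ]
    by_cases hgl : g = l
    · rw [hgl, φ₁l, hψl, Sym2.map_mk, hσb, hσ m hmb hmy]
    by_cases hgB : g ∈ B
    · rw [hψ g hge hgl, φ₁B g hgB, Sym2.map_map]
      refine sym2_map_congr fun v hv => ?_
      have hvY := hgB.2.2 v hv
      have hvx : v ≠ x := fun h => hx (h ▸ hvY)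
      rw [Function.comp_apply]
      by_cases hvb : v = b
      · rw [hvb, Equiv.swap_apply_left, hσ x hxb hxy, hπ]
      · rw [Equiv.swap_apply_of_ne_of_ne hvb hvx, hσ v hvb hvb]
    · rw [φ₁n g hge hgB, hrest g hge hgl hgB]
  -- the second switching
  have hyb : y ≠ b := fun h => hby h.symm
  have φ₁e' : φ₁ e = s(b, y) := by rw [φ₁e, Equiv.swap_apply_of_ne_of_ne hyb hxy.symm]
  let φ₂ : E → Sym2 V := fun g => if g ∈ B then (φ₁ g).map (Equiv.swap y x) else φ₁ g
  have h2 : Switching φ₁ φ₂ := by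
    refine ⟨y, x, B, hxy.symm, ?_, fun g => by by_cases hg : g ∈ B <;> simp [φ₂, hg]⟩
    rintro w ⟨g, hg, hwg⟩ ⟨g', hg', hwg'⟩
    rw [φ₁B g hg] at hwg
    obtain ⟨v, hv, rfl⟩ := Sym2.mem_map.1 hwg
    have hvY := hg.2.2 v hv
    have hvx : v ≠ x := fun h => hx (h ▸ hvY)
    by_cases hvb : v = b
    · right
      rw [hvb, Equiv.swap_apply_left]
    · rw [Equiv.swap_apply_of_ne_of_ne hvb hvx] at hwg' ⊢
      left
      by_cases hg'e : g' = e
      · rw [hg'e, φ₁e'] at hwg'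
        exact (Sym2.mem_iff.1 hwg').resolve_left hvb
      · rw [φ₁n g' hg'e hg'] at hwg'
        by_cases hg'l : g' = l
        · rw [hg'l, hl] at hwg'
          rcases Sym2.mem_iff.1 hwg' with rfl | rfl
          · exact absurd hvY hm
          · exact absurd rfl hvb
        · exact absurd hvY (hnotB g' hg' hg'e hg'l v hwg')
  have φ₂n : ∀ g, g ∉ B → φ₂ g = φ₁ g := fun g hg => by simp only [φ₂, if_neg hg]
  have hσy : σ y = π b := by rw [hσ₀, if_neg hyb, Equiv.swap_apply_right]
  refine ⟨φ₂, (Relation.ReflTransGen.single h1).tail h2, σ, fun g => ?_⟩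
  by_cases hge : g = e
  · rw [hge, φ₂n e heB, φ₁e', hψe, Sym2.map_mk, hσb, hσy]
  by_cases hgl : g = l
  · rw [hgl, φ₂n l hlB, φ₁l, hψl, Sym2.map_mk, hσb, hσ m hmb hmy]
  by_cases hgB : g ∈ B
  · have : φ₂ g = ((φ g).map (Equiv.swap b x)).map (Equiv.swap y x) := by
      simp only [φ₂, if_pos hgB, φ₁B g hgB]
    rw [hψ g hge hgl, this, Sym2.map_map, Sym2.map_map]
    refine sym2_map_congr fun v hv => ?_
    have hvY := hgB.2.2 v hv
    have hvx : v ≠ x := fun h => hx (h ▸ hvY)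
    rw [Function.comp_apply, Function.comp_apply]
    by_cases hvb : v = b
    · rw [hvb, Equiv.swap_apply_left, Equiv.swap_apply_right, hσy]
    · rw [Equiv.swap_apply_of_ne_of_ne hvb hvx]
      by_cases hvy : v = y
      · rw [hvy, Equiv.swap_apply_left, hσ x hxb hxy, hπ]
      · rw [Equiv.swap_apply_of_ne_of_ne hvy hvx, hσ v hvb hvy]
  · rw [φ₂n g hgB, φ₁n g hge hgB, hrest g hge hgl hgB]

end Switching

/-! ### Two-edge cuts. -/

section Cut

variable {V : Type*}

theorem crosses_compl {A : Set V} {s : Sym2 V} : Crosses Aᶜ s ↔ Crosses A s := by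
  induction s with
  | _ a b => rw [crosses_mk, crosses_mk, Set.mem_compl_iff, Set.mem_compl_iff, not_iff_not,
      not_iff_not]

/-- No cycle passes through `e` once `r` is deleted, so `e` is a bridge there; `A` is one side of
it. An even set through `e` must cross `A` again, and only `r` is available. -/
theorem exists_cut {G : SimpleGraph V} {e r : G.edgeSet} (her : e ≠ r)
    (h : ∀ C ∈ evenSpace (Subtype.val : G.edgeSet → Sym2 V), e ∈ C → r ∈ C)
    (hex : ∃ C ∈ evenSpace (Subtype.val : G.edgeSet → Sym2 V), e ∈ C) :
    ∃ A : Set V, ∀ g : G.edgeSet, Crosses A (g : Sym2 V) ↔ g = e ∨ g = r := by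
  obtain ⟨e, he⟩ := e
  induction e with
  | _ x y =>
  set G₁ := G.deleteEdges {(r : Sym2 V)} with hG₁
  have hle : G₁ ≤ G := SimpleGraph.deleteEdges_le _
  have hadj : G₁.Adj x y := by
    rw [hG₁, SimpleGraph.deleteEdges_adj]
    exact ⟨he, fun h => her (Subtype.ext h)⟩
  have hnot : ¬ (G₁.deleteEdges {s(x, y)}).Reachable x y := by
    intro hreach
    obtain ⟨u, p, hp, hep⟩ := SimpleGraph.adj_and_reachable_delete_edges_iff_exists_cycle.1
      ⟨hadj, hreach⟩
    have hC : IsCircuit G {d : G.edgeSet | (d : Sym2 V) ∈ (p.mapLe hle).edges} :=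
      ⟨u, p.mapLe hle, hp.mapLe hle, fun _ => Iff.rfl⟩
    have hr := h _ (isCircuit_mem_evenSpace hC) (by
      simpa only [Set.mem_ofPred_eq, SimpleGraph.Walk.edges_mapLe_eq_edges] using hep)
    rw [Set.mem_ofPred_eq, SimpleGraph.Walk.edges_mapLe_eq_edges] at hr
    have := p.edges_subset_edgeSet hr
    rw [hG₁, SimpleGraph.edgeSet_deleteEdges] at this
    exact this.2 rfl
  set A : Set V := {z | (G₁.deleteEdges {s(x, y)}).Reachable x z} with hA
  have hx : x ∈ A := SimpleGraph.Reachable.refl x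
  have hcross : ∀ g : G.edgeSet, Crosses A (g : Sym2 V) → g = ⟨s(x, y), he⟩ ∨ g = r := by
    rintro ⟨g, hg⟩ ⟨a, ha, b, hb, hab⟩
    by_contra! hne
    apply hb
    refine SimpleGraph.Reachable.trans ha (SimpleGraph.Adj.reachable ?_)
    simp only at hab
    subst hab
    rw [SimpleGraph.deleteEdges_adj, hG₁, SimpleGraph.deleteEdges_adj]
    exact ⟨⟨hg, fun h => hne.2 (Subtype.ext h)⟩, fun h => hne.1 (Subtype.ext h)⟩
  have hce : Crosses A s(x, y) := crosses_mk.2 fun hiff => hnot (hiff.1 hx)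
  refine ⟨A, fun g => ⟨hcross g, ?_⟩⟩
  rintro (rfl | rfl)
  · exact hce
  · obtain ⟨C, hC, heC⟩ := hex
    obtain ⟨e', -, hne, hc⟩ := exists_ne_crosses hC heC hce
    rwa [← (hcross e' hc).resolve_left hne]

end Cut

/-! ### Regrouping one edge at a time by switchings. -/

section Insert

variable {V E F : Type*} {φ : E → Sym2 V}

/-- Contracting one more edge merges only the class of `x` with that of `y`. -/
theorem eq_of_toContracted_insert {S : Set E} {e : E} {x y : V} (he : φ e = s(x, y)) {u v : V}
    (h : toContracted φ (insert e S) u = toContracted φ (insert e S) v) :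
    toContracted φ S u = toContracted φ S v ∨
      (toContracted φ S u = toContracted φ S x ∧ toContracted φ S v = toContracted φ S y) ∨
      (toContracted φ S u = toContracted φ S y ∧ toContracted φ S v = toContracted φ S x) := by
  replace h := Quot.eqvGen_exact h
  induction h with
  | rel u v h =>
    obtain ⟨g, rfl | hg, hgu⟩ := h
    · rw [he] at hgu
      rcases Sym2.eq_iff.1 hgu with ⟨rfl, rfl⟩ | ⟨rfl, rfl⟩
      · exact Or.inr (Or.inl ⟨rfl, rfl⟩)
      · exact Or.inr (Or.inr ⟨rfl, rfl⟩)
    · exact Or.inl (toContracted_eq hg hgu)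
  | refl u => exact Or.inl rfl
  | symm u v h ih => grind
  | trans u v w h h' ih ih' => grind

/-- The map of the vertices when one more edge is contracted and inserted again. -/
def insertMap (φ : E → Sym2 V) (S : Set E) (e : E) :
    Contracted φ S ⊕ S → Contracted φ (insert e S) ⊕ (insert e S : Set E) :=
  Sum.map (Quot.map id fun _ _ ⟨g, hg, h⟩ => ⟨g, Set.mem_insert_of_mem e hg, h⟩)
    fun s => ⟨s, Set.mem_insert_of_mem e s.2⟩

theorem insertMap_inl {S : Set E} {e : E} (v : V) :
    insertMap φ S e (Sum.inl (toContracted φ S v)) =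
      Sum.inl (toContracted φ (insert e S) v) := rfl

theorem ne_iff_exists_insertMap {S : Set E} {e : E} (heS : e ∉ S)
    (w : Contracted φ (insert e S) ⊕ (insert e S : Set E)) :
    w ≠ Sum.inr ⟨e, Set.mem_insert e S⟩ ↔ ∃ v, insertMap φ S e v = w := by
  constructor
  · intro hw
    rcases w with q | ⟨s, rfl | hs⟩
    · obtain ⟨v, rfl⟩ := Quot.exists_rep q
      exact ⟨Sum.inl (toContracted φ S v), rfl⟩
    · exact absurd rfl hw
    · exact ⟨Sum.inr ⟨s, hs⟩, rfl⟩
  · rintro ⟨q | s, rfl⟩ h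
    · exact nomatch h
    · have := congrArg Subtype.val (Sum.inr.inj h)
      have hse : (s : E) = e := this
      exact heS (hse ▸ s.2)

theorem insertMap_eq {S : Set E} {e : E} {x y : V} (he : φ e = s(x, y))
    {u v : Contracted φ S ⊕ S} (hu : u ≠ Sum.inl (toContracted φ S y))
    (hv : v ≠ Sum.inl (toContracted φ S y)) (h : insertMap φ S e u = insertMap φ S e v) :
    u = v := by
  rcases u with u | u <;> rcases v with v | v
  · obtain ⟨u, rfl⟩ := Quot.exists_rep u
    obtain ⟨v, rfl⟩ := Quot.exists_rep v
    rcases eq_of_toContracted_insert he (Sum.inl.inj h) with h | h | h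
    · exact congrArg Sum.inl h
    · exact absurd (congrArg Sum.inl h.2) hv
    · exact absurd (congrArg Sum.inl h.1) hu
  · exact nomatch h
  · exact nomatch h
  · have := congrArg Subtype.val (Sum.inr.inj h)
    exact congrArg Sum.inr (Subtype.ext this)

theorem start_insert {S : Set E} {e g : E} (hg : g ≠ e) :
    start φ (insert e S) g = insertMap φ S e (start φ S g) := by
  by_cases h : g ∈ S
  · rw [start_of_mem h, start_of_mem (Set.mem_insert_of_mem e h)]
    rfl
  · rw [start_of_notMem h, start_of_notMem fun h' => h'.elim hg h, insertMap_inl]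

variable [LinearOrder E] [WellFoundedLT E] {f : E → F}

/-- Since `e` is later than all of `S`, it is appended at the end of its chain. Only the former last
edge of that chain would get a new end, and `hnext` excludes it. -/
theorem regroup_insert {S : Set E} {e g : E} (hlt : ∀ s ∈ S, s < e) (hg : g ≠ e)
    (hnext : (g ∈ S ∨ lead f g = g) → f g = f e → (later f S g).Nonempty) :
    regroup φ f (insert e S) g = (regroup φ f S g).map (insertMap φ S e) := by
  rw [regroup, regroup, Sym2.map_mk, start_insert hg]
  congr 2
  have hiff : g ∈ insert e S ↔ g ∈ S := ⟨fun h => h.resolve_left hg, Or.inr⟩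
  by_cases hc : g ∈ S ∨ lead f g = g
  · have hc' : g ∈ insert e S ∨ lead f g = g := hc.imp_left hiff.2
    by_cases h : (later f S g).Nonempty
    · have hmem : next f S g h ∈ later f (insert e S) g :=
        ⟨Or.inr (next_mem h).1, (next_mem h).2⟩
      have heq : next f (insert e S) g ⟨_, hmem⟩ = next f S g h := by
        refine next_eq_of_forall_le _ hmem fun x hx => ?_
        rcases hx.1 with rfl | hxS
        · exact (hlt _ (next_mem h).1).le
        · exact next_le h ⟨hxS, hx.2⟩
      rw [finish_of_nonempty hc h, finish_of_nonempty hc' ⟨_, hmem⟩]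
      exact congrArg Sum.inr (Subtype.ext heq)
    · have h' : ¬ (later f (insert e S) g).Nonempty := by
        rintro ⟨x, rfl | hxS, hx⟩
        · exact h (hnext hc hx.2.symm)
        · exact h ⟨x, hxS, hx⟩
      rw [finish_of_not_nonempty hc h, finish_of_not_nonempty hc' h', insertMap_inl]
  · have hS : g ∉ S := fun h => hc (Or.inl h)
    have hl : lead f g ≠ g := fun h => hc (Or.inr h)
    rw [finish_of_notMem hS hl, finish_of_notMem (fun h => hS (hiff.1 h)) hl, insertMap_inl]

/-- The two-edge cut formed by `e` and its leading edge in the original graph becomes the cut formed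
by `e` and the last edge `l` of the chain, to which `switchEquiv_of_cut` applies. -/
theorem switchEquiv_regroup_insert {S : Set E} (hfin : S.Finite) (hS : S ⊆ tails f) {e : E}
    (he : e ∈ tails f) (hlt : ∀ s ∈ S, s < e) {A : Set V}
    (hA : ∀ g, Crosses A (φ g) ↔ g = e ∨ g = lead f e) (htgt : tgt φ (lead f e) ∈ A) :
    SwitchEquiv (regroup φ f S) (regroup φ f (insert e S)) := by
  set r := lead f e with hr
  have heS : e ∉ S := fun h => lt_irrefl _ (hlt e h)
  have hrS : r ∉ S := fun h => lead_notMem_tails e (hS h)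
  have hlr : lead f r = r := lead_lead e
  have hre : r < e := lt_of_le_of_ne (lead_le e) he
  -- the last edge of the chain
  obtain ⟨l, ⟨hlS, hlf⟩, hlmax⟩ : ∃ l, ((l ∈ S ∨ lead f l = l) ∧ f l = f e) ∧
      ∀ g, (g ∈ S ∨ lead f g = g) ∧ f g = f e → g ≤ l := by
    have hfin' : {g | (g ∈ S ∨ lead f g = g) ∧ f g = f e}.Finite := by
      refine (hfin.insert r).subset ?_
      rintro g ⟨hg | hg, hgf⟩
      · exact Or.inr hg
      · left
        rw [← hg, lead_congr hgf]
    exact Set.exists_max_image _ id hfin' ⟨r, Or.inr hlr, apply_lead f e⟩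
  have hll : lead f l = r := lead_congr hlf
  have hle : l < e := by
    rcases hlS with h | h
    · exact hlt l h
    · rw [← h, hll]; exact hre
  have hlate : ¬ (later f S l).Nonempty := by
    rintro ⟨x, hxS, hx, hxf⟩
    exact absurd (hlmax x ⟨Or.inl hxS, hxf.trans hlf⟩) (not_le.2 hx)
  have hlate' : ∀ g, (g ∈ S ∨ lead f g = g) → f g = f e → g ≠ l → (later f S g).Nonempty := by
    intro g hg hgf hgl
    have hlt' : g < l := lt_of_le_of_ne (hlmax g ⟨hg, hgf⟩) hgl
    refine ⟨l, hlS.resolve_right fun h => ?_, hlt', hlf.trans hgf.symm⟩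
    have := lead_le_of_eq (f := f) (g := l) (hgf.trans hlf.symm)
    exact absurd (h ▸ this) (not_le.2 hlt')
  -- the two sides
  have hAmk : ∀ g, (src φ g ∈ A ↔ tgt φ g ∈ A) ↔ ¬ (g = e ∨ g = r) := by
    intro g
    rw [← hA g, ← mk_src_tgt φ g, crosses_mk, not_not]
  have hsrc : src φ r ∉ A := fun h => (not_iff_not.2 (hAmk r)).2 (by simp) ⟨fun _ => htgt, fun _ => h⟩
  -- Every inserted vertex is put on the side of the source of its leading edge. In the chain of `r`
  -- only the last edge then crosses; in any other chain both ends lie on the same side, so none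
  -- does.
  let Y : Set (Contracted φ S ⊕ S) := {w | Sum.elim
    (Quot.lift (fun v => v ∈ A) fun u v ⟨g, hg, hguv⟩ => propext <| by
      have h1 : ¬ Crosses A (φ g) := fun h => by
        rcases (hA g).1 h with rfl | rfl
        · exact heS hg
        · exact hrS hg
      rwa [hguv, crosses_mk, not_not] at h1)
    (fun s => lead f (s : E) ≠ r ∧ src φ (lead f (s : E)) ∈ A) w}
  have hYinl : ∀ v, Sum.inl (toContracted φ S v) ∈ Y ↔ v ∈ A := fun v => Iff.rfl
  have hYinr : ∀ s : S, Sum.inr s ∈ Y ↔ lead f (s : E) ≠ r ∧ src φ (lead f (s : E)) ∈ A :=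
    fun s => Iff.rfl
  have hYstart : ∀ g, (g ∈ S ∨ lead f g = g) →
      (start φ S g ∈ Y ↔ lead f g ≠ r ∧ src φ (lead f g) ∈ A) := by
    intro g hg
    by_cases hgS : g ∈ S
    · rw [start_of_mem hgS, hYinr]
    · have := hg.resolve_left hgS
      rw [start_of_notMem hgS, hYinl, this]
      refine ⟨fun h => ⟨?_, h⟩, fun h => h.2⟩
      rintro rfl
      exact hsrc h
  have hYfinish : ∀ g, (g ∈ S ∨ lead f g = g) → g ≠ l →
      (finish φ f S g ∈ Y ↔ lead f g ≠ r ∧ src φ (lead f g) ∈ A) := by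
    intro g hg hgl
    by_cases h : (later f S g).Nonempty
    · rw [finish_of_nonempty hg h, hYinr, lead_congr (apply_next h)]
    · have hgr : lead f g ≠ r := fun h' => h (hlate' g hg (by
        rw [← apply_lead f g, h', hr, apply_lead f]) hgl)
      have hge : lead f g ≠ e := fun h' => lead_notMem_tails g (h' ▸ he)
      rw [finish_of_not_nonempty hg h, hYinl, ← (hAmk (lead f g)).2 (by tauto)]
      exact ⟨fun h => ⟨hgr, h⟩, fun h => h.2⟩
  have hY : ∀ g, g ≠ e → g ≠ l →
      (∀ v ∈ regroup φ f S g, v ∈ Y) ∨ ∀ v ∈ regroup φ f S g, v ∉ Y := by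
    intro g hge hgl
    have key : start φ S g ∈ Y ↔ finish φ f S g ∈ Y := by
      by_cases hg : g ∈ S ∨ lead f g = g
      · rw [hYstart g hg, hYfinish g hg hgl]
      · push Not at hg
        rw [start_of_notMem hg.1, finish_of_notMem hg.1 hg.2, hYinl, hYinl, hAmk]
        rintro (rfl | rfl)
        · exact hge rfl
        · exact hg.2 hlr
    by_cases h : start φ S g ∈ Y
    · left
      intro v hv
      rcases Sym2.mem_iff.1 hv with rfl | rfl
      exacts [h, key.1 h]
    · right
      intro v hv
      rcases Sym2.mem_iff.1 hv with rfl | rfl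
      exacts [h, fun h' => h (key.2 h')]
  obtain ⟨x, y, hxy, hx, hy⟩ : ∃ x y, φ e = s(x, y) ∧ x ∉ A ∧ y ∈ A := by
    obtain ⟨y, hy, x, hx, h⟩ := (hA e).2 (Or.inl rfl)
    exact ⟨x, y, h.trans Sym2.eq_swap, hx, hy⟩
  have hreg : regroup φ f S e =
      s(Sum.inl (toContracted φ S x), Sum.inl (toContracted φ S y)) := by
    rw [regroup, start_of_notMem heS, finish_of_notMem heS he]
    have := congrArg (Sym2.map fun v => (Sum.inl (toContracted φ S v) : Contracted φ S ⊕ S))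
      ((mk_src_tgt φ e).trans hxy)
    simpa only [Sym2.map_mk] using this
  have hmemE : e ∈ later f (insert e S) l := ⟨Or.inl rfl, hle, hlf.symm⟩
  refine switchEquiv_of_cut Y (e := e) (l := l) (x := Sum.inl (toContracted φ S x))
    (y := Sum.inl (toContracted φ S y)) (m := start φ S l)
    (b := Sum.inl (toContracted φ S (tgt φ r))) hx hy ?_ htgt hle.ne' hreg ?_ hY
    (insertMap φ S e) (Sum.inr ⟨e, Set.mem_insert e S⟩) ?_ ?_ (ne_iff_exists_insertMap heS) ?_ ?_ ?_
  · rw [hYstart l hlS]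
    exact fun h => h.1 hll
  · rw [regroup, finish_of_not_nonempty hlS hlate, hll]
  · rw [insertMap_inl, insertMap_inl, toContracted_eq (Set.mem_insert e S) hxy]
  · exact fun u v hu hv h => insertMap_eq hxy hu hv h
  · exact fun g hge hgl => regroup_insert hlt hge fun hg hgf => hlate' g hg hgf hgl
  · have hmin : ∀ z ∈ later f (insert e S) l, e ≤ z := by
      rintro z ⟨rfl | hz, hz'⟩
      · exact le_rfl
      · exact absurd ⟨z, hz, hz'⟩ hlate
    have hnext : next f (insert e S) l ⟨e, hmemE⟩ = e := next_eq_of_forall_le _ hmemE hmin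
    have hfinish : finish φ f (insert e S) l = Sum.inr ⟨e, Set.mem_insert e S⟩ :=
      (finish_of_nonempty (hlS.imp_left (Set.mem_insert_of_mem e)) ⟨e, hmemE⟩).trans
        (congrArg Sum.inr (Subtype.ext hnext))
    rw [regroup, start_insert hle.ne, hfinish]
  · have h' : ¬ (later f (insert e S) e).Nonempty := by
      rintro ⟨z, rfl | hz, hz', -⟩
      · exact lt_irrefl _ hz'
      · exact lt_asymm hz' (hlt z hz)
    rw [regroup, start_of_mem (Set.mem_insert e S),
      finish_of_not_nonempty (Or.inl (Set.mem_insert e S)) h', insertMap_inl]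

theorem switchEquiv_regroup_empty : SwitchEquiv φ (regroup φ f ∅) := by
  let σ₀ : V → Contracted φ (∅ : Set E) ⊕ (∅ : Set E) := fun v => Sum.inl (toContracted φ ∅ v)
  have hinj : Function.Injective σ₀ := by
    intro u v h
    replace h := Quot.eqvGen_exact (Sum.inl.inj h)
    induction h with
    | rel u v h => exact absurd h.choose_spec.1 (Set.notMem_empty _)
    | refl u => rfl
    | symm u v h ih => exact ih.symm
    | trans u v w h h' ih ih' => exact ih.trans ih'
  have hsurj : Function.Surjective σ₀ := by
    rintro (q | s)
    · obtain ⟨v, rfl⟩ := Quot.exists_rep q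
      exact ⟨v, rfl⟩
    · exact absurd s.2 (Set.notMem_empty _)
  refine ⟨φ, .refl, Equiv.ofBijective σ₀ ⟨hinj, hsurj⟩, fun e => ?_⟩
  have hfinish : finish φ f ∅ e = σ₀ (tgt φ e) := by
    have hn : ¬ (later f ∅ e).Nonempty := fun ⟨x, hx⟩ => hx.1
    by_cases h : lead f e = e
    · rw [finish_of_not_nonempty (Or.inr h) hn, h]
    · rw [finish_of_notMem (Set.notMem_empty e) h]
  rw [regroup, start_of_notMem (Set.notMem_empty e), hfinish]
  conv_rhs => rw [← mk_src_tgt φ e, Sym2.map_mk]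
  rfl

theorem switchEquiv_regroup [Finite E]
    (hcut : ∀ e ∈ tails f, ∃ A : Set V, ∀ g, Crosses A (φ g) ↔ g = e ∨ g = lead f e) :
    SwitchEquiv φ (regroup φ f (tails f)) := by
  have key : ∀ S : Finset E, (S : Set E) ⊆ tails f → SwitchEquiv φ (regroup φ f (S : Set E)) := by
    intro S
    -- Insertion in increasing order makes each new edge the last one of its chain.
    induction S using Finset.induction_on_max with
    | empty =>
      intro _
      rw [Finset.coe_empty]
      exact switchEquiv_regroup_empty
    | insert e S hlt ih =>
      intro hS
      rw [Finset.coe_insert] at hS ⊢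
      have he : e ∈ tails f := hS (Set.mem_insert _ _)
      have hS' : (S : Set E) ⊆ tails f := fun s hs => hS (Set.mem_insert_of_mem _ hs)
      refine (ih hS').trans ?_
      obtain ⟨A, hA⟩ := hcut e he
      by_cases h : tgt φ (lead f e) ∈ A
      · exact switchEquiv_regroup_insert S.finite_toSet hS' he hlt hA h
      · exact switchEquiv_regroup_insert S.finite_toSet hS' he hlt
          (fun g => crosses_compl.trans (hA g)) h
  have hfin : (tails f).Finite := Set.toFinite _
  have := key hfin.toFinset (by rw [hfin.coe_toFinset])
  rwa [hfin.coe_toFinset] at this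

end Insert

/-! ### Edge-indexed graphs as simple graphs. -/

section GraphOf

variable {V W E F : Type*}

/-- An edge indexed graph without loops and parallel edges. -/
def IsSimple (φ : E → Sym2 V) : Prop := Function.Injective φ ∧ ∀ e, ¬ (φ e).IsDiag

theorem IsSimple.not_subset_pair {φ : E → Sym2 V} (hφ : IsSimple φ) {C : Set E}
    (hC : C ∈ evenSpace φ) (hne : C.Nonempty) (a b : E) : ¬ C ⊆ {a, b} := by
  intro hab
  obtain ⟨e, he⟩ := hne
  obtain ⟨x, y, hxy⟩ : ∃ x y, φ e = s(x, y) := ⟨_, _, (mk_src_tgt φ e).symm⟩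
  have hne : x ≠ y := fun h => hφ.2 e (by rw [hxy, Sym2.mk_isDiag_iff]; exact h)
  have hend : ∀ {A : Set V} {s : Sym2 V} {z : V}, A = {z} → Crosses A s → z ∈ s := by
    rintro _ _ z rfl ⟨u, hu, v, -, rfl⟩
    rw [← Set.mem_singleton_iff.1 hu]
    exact Sym2.mem_mk_left _ _
  obtain ⟨e₁, h₁, hne₁, hc₁⟩ := exists_ne_crosses hC (A := {x}) he
    (by rw [hxy, crosses_mk]; simp [hne.symm])
  obtain ⟨e₂, h₂, hne₂, hc₂⟩ := exists_ne_crosses hC (A := {y}) he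
    (by rw [hxy, crosses_mk]; simp [hne])
  have h12 : e₁ = e₂ := by
    rcases hab he with rfl | rfl <;> rcases hab h₁ with rfl | rfl <;>
      rcases hab h₂ with rfl | rfl <;> first | rfl | contradiction
  subst h12
  have := (Sym2.mem_and_mem_iff hne).1 ⟨hend rfl hc₁, hend rfl hc₂⟩
  exact hne₁ (hφ.1 (this.trans hxy.symm))

/-- A loop is an even set with one element, a pair of parallel edges one with two. Simplicity thus
depends on the even sets alone. -/
theorem isSimple_of_not_subset_pair {φ : E → Sym2 V}
    (h : ∀ C ∈ evenSpace φ, C.Nonempty → ∀ a b, ¬ C ⊆ {a, b}) : IsSimple φ := by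
  refine ⟨fun a b hab => ?_, fun e he => ?_⟩
  · by_contra hne
    refine h {a, b} ⟨Set.toFinite _, ?_⟩ ⟨a, Or.inl rfl⟩ a b subset_rfl
    rw [finsum_mem_pair hne, hab, add_self_finsupp]
  · refine h {e} ⟨Set.toFinite _, ?_⟩ ⟨e, rfl⟩ e e (by simp)
    rw [finsum_mem_singleton]
    obtain ⟨x, y, hxy⟩ : ∃ x y, φ e = s(x, y) := ⟨_, _, (mk_src_tgt φ e).symm⟩
    rw [hxy, Sym2.mk_isDiag_iff] at he
    rw [hxy, he, bd_diag]

theorem isSimple_val (G : SimpleGraph V) : IsSimple (Subtype.val : G.edgeSet → Sym2 V) :=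
  ⟨Subtype.val_injective, fun e => G.not_isDiag_of_mem_edgeSet e.2⟩

/-- The simple graph with the given edges. -/
def graphOf (φ : E → Sym2 V) : SimpleGraph V := SimpleGraph.fromEdgeSet (Set.range φ)

theorem IsSimple.edgeSet_graphOf {φ : E → Sym2 V} (hφ : IsSimple φ) :
    (graphOf φ).edgeSet = Set.range φ := by
  rw [graphOf, SimpleGraph.edgeSet_fromEdgeSet]
  refine sdiff_eq_left.2 (Set.disjoint_left.2 ?_)
  rintro _ ⟨e, rfl⟩ h
  exact hφ.2 e h

theorem IsSimple.adj_iff {φ : E → Sym2 V} (hφ : IsSimple φ) {a b : V} :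
    (graphOf φ).Adj a b ↔ ∃ e, φ e = s(a, b) := by
  rw [← SimpleGraph.mem_edgeSet, hφ.edgeSet_graphOf]
  rfl

/-- The enumeration of the edges of the graph with the given edges. -/
noncomputable def IsSimple.equiv {φ : E → Sym2 V} (hφ : IsSimple φ) : E ≃ (graphOf φ).edgeSet :=
  (Equiv.ofInjective φ hφ.1).trans (Equiv.setCongr hφ.edgeSet_graphOf.symm)

theorem IsSimple.coe_equiv {φ : E → Sym2 V} (hφ : IsSimple φ) (e : E) :
    (hφ.equiv e : Sym2 V) = φ e := rfl

theorem IsSimple.isCircuit_image {φ : E → Sym2 V} (hφ : IsSimple φ) {C : Set E} :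
    IsCircuit (graphOf φ) (hφ.equiv '' C) ↔ IsMinimalMember (evenSpace φ) C :=
  isCircuit_image_iff hφ.equiv hφ.coe_equiv

end GraphOf

/-! ### Simplicity, suspended chains and absence of isolated vertices in the two constructed graphs.
-/

section Quotient

variable {V W E F : Type*} [LinearOrder E] [WellFoundedLT E] {φ : E → Sym2 V} {f : E → F}

theorem isMinimalMember_image (hf : Function.Surjective f)
    (hsat : ∀ C ∈ evenSpace φ, Saturated f C) {C : Set E}
    (hC : IsMinimalMember (evenSpace φ) C) :
    IsMinimalMember (evenSpace (contraction φ f hf)) (f '' C) := by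
  have hs := hsat C hC.1
  refine ⟨image_mem_evenSpace_contraction hf hC.1 hs, hC.2.1.image f, fun D hD hDC hne => ?_⟩
  have h1 : f ⁻¹' D ⊆ C := (Set.preimage_mono hDC).trans hs.preimage_image.subset
  rw [← hC.2.2 _ (preimage_mem_evenSpace hf hsat hD) h1 (hne.preimage hf),
    Set.image_preimage_eq _ hf]

theorem isMinimalMember_preimage (hf : Function.Surjective f)
    (hsat : ∀ C ∈ evenSpace φ, Saturated f C) {D : Set F}
    (hD : IsMinimalMember (evenSpace (contraction φ f hf)) D) :
    IsMinimalMember (evenSpace φ) (f ⁻¹' D) := by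
  refine ⟨preimage_mem_evenSpace hf hsat hD.1, hD.2.1.preimage hf, fun C hC hCD hne => ?_⟩
  have hs := hsat C hC
  rw [← hD.2.2 _ (image_mem_evenSpace_contraction hf hC hs) (Set.image_subset_iff.2 hCD)
    (hne.image f), hs.preimage_image]

/-- An even set of the contraction with at most two edges would contain the image of a circuit,
which is a circuit of the simple graph `ψ`. -/
theorem isSimple_contraction {ψ : F → Sym2 W} (hψ : IsSimple ψ) (hf : Function.Surjective f)
    (hsat : ∀ C ∈ evenSpace φ, Saturated f C)
    (hmap : ∀ C, IsMinimalMember (evenSpace φ) C → IsMinimalMember (evenSpace ψ) (f '' C)) :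
    IsSimple (contraction φ f hf) := by
  refine isSimple_of_not_subset_pair fun D hD hne a b hab => ?_
  obtain ⟨g, hg⟩ := hne.preimage hf
  obtain ⟨C, hC, -, hCD⟩ := (isBinarySpace_evenSpace φ).exists_isMinimalMember
    (preimage_mem_evenSpace hf hsat hD) hg
  exact hψ.not_subset_pair (hmap C hC).1 (hmap C hC).2.1 a b
    ((Set.image_subset_iff.2 hCD).trans hab)

theorem isSimple_regroup (hφ : IsSimple φ) (hfin : ∀ d, (f ⁻¹' {d}).Finite)
    (hf : Function.Surjective f) (hsat : ∀ C ∈ evenSpace φ, Saturated f C) :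
    IsSimple (regroup φ f (tails f)) := by
  refine isSimple_of_not_subset_pair fun C hC => ?_
  rw [evenSpace_regroup hfin hf hsat] at hC
  exact hφ.not_subset_pair hC

theorem start_ne_chainEnd {hf : Function.Surjective f} (hL : IsSimple (contraction φ f hf))
    (g : E) : start φ (tails f) g ≠ chainEnd φ f g := by
  by_cases hg : g ∈ tails f
  · rw [start_of_mem hg]
    exact fun h => nomatch h
  · have hl : lead f g = g := not_not.1 hg
    rw [start_of_notMem hg, chainEnd, hl]
    intro h
    apply hL.2 (f g)
    rw [contraction_apply, hl, ← mk_src_tgt φ g, Sym2.map_mk, Sym2.mk_isDiag_iff]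
    exact Sum.inl.inj h

theorem exists_chain_walk {hf : Function.Surjective f} (hL : IsSimple (contraction φ f hf))
    (hK : IsSimple (regroup φ f (tails f))) (hfin : ∀ d, (f ⁻¹' {d}).Finite) (g : E) :
    ∃ p : (graphOf (regroup φ f (tails f))).Walk (start φ (tails f) g) (chainEnd φ f g),
      p.IsPath ∧
      (∀ e, regroup φ f (tails f) e ∈ p.edges ↔ e ∈ insert g (later f (tails f) g)) ∧
      ∀ w ∈ p.support, w = start φ (tails f) g ∨ w = chainEnd φ f g ∨
        ∃ x : tails f, (x : E) ∈ later f (tails f) g ∧ w = Sum.inr x := by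
  induction g using fibre_induction (f := f) (S := tails f) (fibre_finite_later hfin _) with
  | hlast g h =>
    have hadj : (graphOf (regroup φ f (tails f))).Adj (start φ (tails f) g) (chainEnd φ f g) :=
      hK.adj_iff.2 ⟨g, regroup_of_not_nonempty h⟩
    refine ⟨.cons hadj .nil, ?_, fun e => ?_, fun w hw => ?_⟩
    · simp [SimpleGraph.Walk.cons_isPath_iff, hadj.ne]
    · rw [SimpleGraph.Walk.edges_cons, SimpleGraph.Walk.edges_nil, List.mem_singleton,
        ← regroup_of_not_nonempty h, Set.not_nonempty_iff_eq_empty.1 h, hK.1.eq_iff]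
      simp
    · simp only [SimpleGraph.Walk.support_cons, SimpleGraph.Walk.support_nil, List.mem_cons,
        List.not_mem_nil, or_false] at hw
      tauto
  | hstep g h ih =>
    rw [← chainEnd_congr (apply_next h).symm] at ih
    obtain ⟨p, hp, hedges, hsupp⟩ := ih
    have hadj : (graphOf (regroup φ f (tails f))).Adj (start φ (tails f) g)
        (start φ (tails f) (next f (tails f) g h)) :=
      hK.adj_iff.2 ⟨g, regroup_of_nonempty h⟩
    have hsupp' : ∀ w ∈ p.support, w = chainEnd φ f g ∨
        ∃ x : tails f, (x : E) ∈ later f (tails f) g ∧ w = Sum.inr x := by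
      intro w hw
      rcases hsupp w hw with rfl | rfl | ⟨x, hx, rfl⟩
      · exact Or.inr ⟨⟨_, (next_mem h).1⟩, next_mem h, start_of_mem _⟩
      · exact Or.inl rfl
      · refine Or.inr ⟨x, ?_, rfl⟩
        rw [later_next h]
        exact Or.inr hx
    refine ⟨.cons hadj p, ?_, fun e => ?_, fun w hw => ?_⟩
    · rw [SimpleGraph.Walk.cons_isPath_iff]
      refine ⟨hp, fun hmem => ?_⟩
      rcases hsupp' _ hmem with h' | ⟨x, hx, h'⟩
      · exact start_ne_chainEnd hL g h'
      · exact hx.2.1.ne (start_eq_inr.1 h')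
    · rw [SimpleGraph.Walk.edges_cons, List.mem_cons, hedges, ← regroup_of_nonempty h,
        hK.1.eq_iff, ← later_next h]
      rfl
    · rw [SimpleGraph.Walk.support_cons, List.mem_cons] at hw
      exact hw.imp_right (hsupp' w)

theorem exists_fibre_walk {hf : Function.Surjective f} (hL : IsSimple (contraction φ f hf))
    (hK : IsSimple (regroup φ f (tails f))) (hfin : ∀ d, (f ⁻¹' {d}).Finite) {d : F}
    {a b : Contracted φ (tails f)} (hab : contraction φ f hf d = s(a, b)) :
    ∃ p : (graphOf (regroup φ f (tails f))).Walk (Sum.inl a) (Sum.inl b),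
      p.IsPath ∧ (∀ e, regroup φ f (tails f) e ∈ p.edges ↔ f e = d) ∧
      ∀ w ∈ p.support, w = Sum.inl a ∨ w = Sum.inl b ∨ ∃ x : tails f, w = Sum.inr x := by
  obtain ⟨g, rfl⟩ := hf d
  obtain ⟨p, hp, hedges, hsupp⟩ := exists_chain_walk hL hK hfin (lead f g)
  have hedges' : ∀ e, regroup φ f (tails f) e ∈ p.edges ↔ f e = f g := fun e => by
    rw [hedges, insert_lead_later]
    rfl
  have hstart : start φ (tails f) (lead f g) =
      Sum.inl (toContracted φ (tails f) (src φ (lead f g))) :=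
    start_of_notMem (lead_notMem_tails g)
  have hend : chainEnd φ f (lead f g) =
      Sum.inl (toContracted φ (tails f) (tgt φ (lead f g))) := by
    rw [chainEnd, lead_lead]
  rw [contraction_apply, ← mk_src_tgt φ (lead f g), Sym2.map_mk] at hab
  have hsupp' : ∀ w ∈ p.support, w = Sum.inl (toContracted φ (tails f) (src φ (lead f g))) ∨
      w = Sum.inl (toContracted φ (tails f) (tgt φ (lead f g))) ∨
        ∃ x : tails f, w = Sum.inr x := by
    intro w hw
    rcases hsupp w hw with rfl | rfl | ⟨x, -, rfl⟩
    · exact Or.inl hstart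
    · exact Or.inr (Or.inl hend)
    · exact Or.inr (Or.inr ⟨x, rfl⟩)
  rcases Sym2.eq_iff.1 hab with ⟨rfl, rfl⟩ | ⟨rfl, rfl⟩
  · refine ⟨p.copy hstart hend, ?_, ?_, ?_⟩
    · rwa [SimpleGraph.Walk.isPath_copy]
    · simpa only [SimpleGraph.Walk.edges_copy] using hedges'
    · simpa only [SimpleGraph.Walk.support_copy] using hsupp'
  · refine ⟨(p.copy hstart hend).reverse, ?_, ?_, ?_⟩
    · rwa [SimpleGraph.Walk.isPath_reverse_iff, SimpleGraph.Walk.isPath_copy]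
    · simpa only [SimpleGraph.Walk.edges_reverse, List.mem_reverse,
        SimpleGraph.Walk.edges_copy] using hedges'
    · intro w hw
      rw [SimpleGraph.Walk.support_reverse, List.mem_reverse,
        SimpleGraph.Walk.support_copy] at hw
      exact or_left_comm.1 (hsupp' w hw)

/-- The predecessor is the greatest earlier edge of the fibre; it exists because the fibre is
finite. -/
theorem exists_next_eq (hfin : ∀ d, (f ⁻¹' {d}).Finite) {x : E} (hx : x ∈ tails f) :
    ∃ (p : E) (h : (later f (tails f) p).Nonempty), next f (tails f) p h = x := by
  have hfin' : {g | g < x ∧ f g = f x}.Finite := (hfin (f x)).subset fun g hg => hg.2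
  obtain ⟨p, ⟨hp, hpf⟩, hmax⟩ := Set.exists_max_image _ id hfin'
    ⟨lead f x, lt_of_le_of_ne (lead_le x) hx, apply_lead f x⟩
  have hmem : x ∈ later f (tails f) p := ⟨hx, hp, hpf.symm⟩
  refine ⟨p, ⟨x, hmem⟩, next_eq_of_forall_le _ hmem fun y hy => ?_⟩
  by_contra hlt
  exact absurd (hmax y ⟨not_le.1 hlt, hy.2.2.trans hpf⟩) (not_le.2 hy.2.1)

theorem encard_neighborSet_inr (hK : IsSimple (regroup φ f (tails f)))
    (hfin : ∀ d, (f ⁻¹' {d}).Finite) (x : tails f) :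
    ((graphOf (regroup φ f (tails f))).neighborSet (Sum.inr x)).encard = 2 := by
  obtain ⟨x, hx⟩ := x
  obtain ⟨p, hp, rfl⟩ := exists_next_eq hfin hx
  set x := next f (tails f) p hp with hxdef
  have hregx : regroup φ f (tails f) x = s(Sum.inr ⟨x, hx⟩, finish φ f (tails f) x) := by
    rw [regroup, start_of_mem hx]
  have hregp : regroup φ f (tails f) p = s(Sum.inr ⟨x, hx⟩, start φ (tails f) p) := by
    rw [regroup_of_nonempty hp, ← hxdef, start_of_mem hx, Sym2.eq_swap]
  have hpx : p ≠ x := (lt_next hp).ne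
  have hset : (graphOf (regroup φ f (tails f))).neighborSet (Sum.inr ⟨x, hx⟩) =
      {finish φ f (tails f) x, start φ (tails f) p} := by
    ext w
    rw [SimpleGraph.mem_neighborSet, hK.adj_iff, Set.mem_insert_iff, Set.mem_singleton_iff]
    constructor
    · rintro ⟨e, he⟩
      have hcross : Crosses {Sum.inr ⟨x, hx⟩} (regroup φ f (tails f) e) := by
        rw [he, crosses_mk, Set.mem_singleton_iff, Set.mem_singleton_iff]
        intro hiff
        apply hK.2 e
        rw [he, Sym2.mk_isDiag_iff]
        exact (hiff.1 rfl).symm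
      rcases (crosses_regroup_iff hx).1 hcross with rfl | ⟨h, h'⟩
      · rw [hregx] at he
        exact Or.inl (Sym2.congr_right.1 he).symm
      · obtain rfl := next_injective h hp (mem_tails_or e) (mem_tails_or p) h'
        rw [hregp] at he
        exact Or.inr (Sym2.congr_right.1 he).symm
    · rintro (rfl | rfl)
      · exact ⟨x, hregx⟩
      · exact ⟨p, hregp⟩
  rw [hset, Set.encard_pair]
  intro h
  exact hpx (hK.1 (by rw [hregx, hregp, h]))

theorem not_isIsolated_inr (hK : IsSimple (regroup φ f (tails f))) (x : tails f) :
    ¬ (graphOf (regroup φ f (tails f))).IsIsolated (Sum.inr x) := fun hiso =>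
  hiso (finish φ f (tails f) x) (hK.adj_iff.2 ⟨x, by rw [regroup, start_of_mem x.2]⟩)

theorem replacesChains_regroup {hf : Function.Surjective f} (hL : IsSimple (contraction φ f hf))
    (hK : IsSimple (regroup φ f (tails f))) (hfin : ∀ d, (f ⁻¹' {d}).Finite) :
    ReplacesChains (graphOf (regroup φ f (tails f))) (graphOf (contraction φ f hf))
      (hL.equiv ∘ f ∘ hK.equiv.symm) := by
  refine ⟨⟨Sum.inl, Sum.inl_injective⟩, ?_, ?_⟩
  · intro a b hab
    obtain ⟨d, hd⟩ := hL.adj_iff.1 hab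
    obtain ⟨p, hp, hedges, hsupp⟩ := exists_fibre_walk hL hK hfin hd
    refine ⟨p, ?_, ?_, ?_⟩
    · have h0 : p.length ≠ 0 := fun h0 =>
        hab.ne (Sum.inl_injective (SimpleGraph.Walk.eq_of_length_eq_zero h0))
      by_cases h1 : p.length = 1
      · exact Or.inl h1
      · refine Or.inr ⟨hp, by omega, fun w hw hwa hwb => ?_⟩
        obtain ⟨x, rfl⟩ := ((hsupp w hw).resolve_left hwa).resolve_left hwb
        exact encard_neighborSet_inr hK hfin x
    · intro e
      obtain ⟨g, rfl⟩ := hK.equiv.surjective e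
      rw [hK.coe_equiv, hedges, ← hd, Function.comp_apply, Function.comp_apply,
        Equiv.symm_apply_apply, hL.coe_equiv, hL.1.eq_iff]
    · intro c hc
      rcases hsupp _ hc with h | h | ⟨x, h⟩
      · exact Or.inl (Sum.inl_injective h)
      · exact Or.inr (Sum.inl_injective h)
      · exact nomatch h
  · rintro (q | x) hv
    · exact absurd ⟨q, rfl⟩ hv
    · exact not_isIsolated_inr hK x

/-- The contraction has more than one vertex, since otherwise its edges would be loops. A walk
leaving the class of `v` does so along an edge that is not contracted, hence leading. -/
theorem not_isIsolated_contraction {G : SimpleGraph V} (hG : TwoConnected G)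
    (hφ : ∀ x y, G.Adj x y → ∃ e, φ e = s(x, y)) {hf : Function.Surjective f}
    (hL : IsSimple (contraction φ f hf)) (q : Contracted φ (tails f)) :
    ¬ (graphOf (contraction φ f hf)).IsIsolated q := by
  obtain ⟨v, rfl⟩ := Quot.exists_rep q
  have hne : ∃ u, toContracted φ (tails f) u ≠ toContracted φ (tails f) v := by
    by_contra! h
    obtain ⟨w, hw, -⟩ := hG.exists_third v v
    obtain ⟨p⟩ := hG.preconnected v w
    obtain ⟨d, -, -⟩ := p.exists_boundary_dart {v} rfl hw
    obtain ⟨e, -⟩ := hφ _ _ d.adj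
    apply hL.2 (f e)
    rw [contraction_apply, ← mk_src_tgt φ (lead f e), Sym2.map_mk, Sym2.mk_isDiag_iff]
    exact (h _).trans (h _).symm
  obtain ⟨u, hu⟩ := hne
  obtain ⟨p⟩ := hG.preconnected v u
  obtain ⟨d, -, hd, hd'⟩ := p.exists_boundary_dart
    {x | toContracted φ (tails f) x = toContracted φ (tails f) v} rfl hu
  obtain ⟨e, he⟩ := hφ _ _ d.adj
  have hfst : toContracted φ (tails f) d.fst = toContracted φ (tails f) v := hd
  have hlead : lead f e = e := by
    by_contra hl
    exact hd' ((toContracted_eq (S := tails f) hl he).symm.trans hfst)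
  refine fun hiso => hiso (toContracted φ (tails f) d.snd) (hL.adj_iff.2 ⟨f e, ?_⟩)
  rw [contraction_apply, hlead, he, Sym2.map_mk, hfst]
  rfl

theorem not_isIsolated_regroup {hf : Function.Surjective f} (hL : IsSimple (contraction φ f hf))
    (hK : IsSimple (regroup φ f (tails f))) (hfin : ∀ d, (f ⁻¹' {d}).Finite)
    (hiso : ∀ q, ¬ (graphOf (contraction φ f hf)).IsIsolated q)
    (w : Contracted φ (tails f) ⊕ tails f) :
    ¬ (graphOf (regroup φ f (tails f))).IsIsolated w := by
  rcases w with q | x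
  · obtain ⟨b, hb⟩ : ∃ b, (graphOf (contraction φ f hf)).Adj q b := by
      by_contra! h
      exact hiso q h
    obtain ⟨d, hd⟩ := hL.adj_iff.1 hb
    obtain ⟨p, -, -, -⟩ := exists_fibre_walk hL hK hfin hd
    generalize hw : (Sum.inl q : Contracted φ (tails f) ⊕ tails f) = w at p ⊢
    cases p with
    | nil => exact absurd (Sum.inl_injective hw) hb.ne
    | cons h p => exact fun hiso => hiso _ h
  · exact not_isIsolated_inr hK x

end Quotient

/-! ### Application to circuit surjections and assembly of the factorisation. -/

theorem IsCircuitSurjection.saturated {V W : Type*} {G : SimpleGraph V} {H : SimpleGraph W}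
    {f : G.edgeSet → H.edgeSet} (hf : IsCircuitSurjection G H f) (hG : TwoConnected G)
    (hH : ¬ IsCircuitGraph H) :
    ∀ C ∈ evenSpace (Subtype.val : G.edgeSet → Sym2 V), Saturated f C := by
  intro C hC g hg g' hgg
  obtain ⟨D, hD, hgD, hDC⟩ := (isBinarySpace_evenSpace _).exists_isMinimalMember hC hg
  refine hDC ((isBinarySpace_evenSpace _).mem_of_apply_eq
    (isBinarySpace_evenSpace (Subtype.val : H.edgeSet → Sym2 W)) hG.linked (f := f) ?_ ?_ hD hgD hgg)
  · intro C hC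
    exact isCircuit_iff.1 (hf.map_circuit C (isCircuit_iff.2 hC))
  · intro C hC
    -- A circuit whose image is all of `H` would make `H` a circuit.
    by_contra! h
    refine hH ⟨hf.not_isIsolated, ?_⟩
    have : f '' C = Set.univ := Set.eq_univ_of_forall fun d => by
      obtain ⟨e, rfl⟩ := hf.surjective d
      exact h e
    exact this ▸ hf.map_circuit C (isCircuit_iff.2 hC)

end CircuitMaps

open CircuitMaps in
theorem theorem1p1 {V : Type u} {W : Type v} (G : SimpleGraph V) (H : SimpleGraph W)
    (f : G.edgeSet → H.edgeSet) (hG : CircuitMaps.TwoConnected G)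
    (hH : ¬ CircuitMaps.IsCircuitGraph H) (hf : CircuitMaps.IsCircuitSurjection G H f) :
    (∃ (V₁ V₂ : Type u) (K : SimpleGraph V₁) (L : SimpleGraph V₂)
      (k : G.edgeSet → K.edgeSet) (h : K.edgeSet → L.edgeSet) (q : L.edgeSet → H.edgeSet),
      f = q ∘ h ∘ k ∧
      CircuitMaps.IsCircuitIsomorphism G K k ∧
      (Finite V → CircuitMaps.IsTwoIsomorphism G K k) ∧
      CircuitMaps.IsCircuitSurjection K L h ∧
      CircuitMaps.ReplacesChains K L h ∧
      (∀ D : Set L.edgeSet, CircuitMaps.IsCircuit L D → CircuitMaps.IsCircuit K (h ⁻¹' D)) ∧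
      CircuitMaps.IsCircuitInjection L H q) ∧
    ∀ e : H.edgeSet, (f ⁻¹' {e}).Finite := by
  have hsat := hf.saturated hG hH
  have hsurj := hf.surjective
  have hfin : ∀ e : H.edgeSet, (f ⁻¹' {e}).Finite := by
    intro e
    obtain ⟨g, rfl⟩ := hsurj e
    -- Each edge lies on a circuit, which is finite and contains the whole fibre.
    obtain ⟨C, hC, hg, -⟩ := hG.linked g g
    exact hC.1.1.subset fun g' hg' => hsat C hC.1 g hg g' hg'.symm
  refine ⟨?_, hfin⟩
  -- An arbitrary well-order serves to pick the leading edges and to arrange each fibre along its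
  -- chain.
  obtain ⟨_, _⟩ := exists_wellFoundedLT G.edgeSet
  have hL : IsSimple (contraction (Subtype.val : G.edgeSet → Sym2 V) f hsurj) :=
    isSimple_contraction (isSimple_val H) hsurj hsat fun C hC =>
      isCircuit_iff.1 (hf.map_circuit C (isCircuit_iff.2 hC))
  have hK : IsSimple (regroup (Subtype.val : G.edgeSet → Sym2 V) f (tails f)) :=
    isSimple_regroup (isSimple_val G) hfin hsurj hsat
  have heven := evenSpace_regroup hfin hsurj hsat
  have hisoL := not_isIsolated_contraction hG (fun x y h => ⟨⟨s(x, y), h⟩, rfl⟩) hL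
  have hisoK := not_isIsolated_regroup hL hK hfin hisoL
  have hpre : ∀ D, (hL.equiv ∘ f ∘ hK.equiv.symm) ⁻¹' (hL.equiv '' D) = hK.equiv '' (f ⁻¹' D) := by
    intro D
    rw [Equiv.image_eq_preimage_symm, Equiv.image_eq_preimage_symm]
    ext e
    simp
  refine ⟨_, _, graphOf (regroup (Subtype.val : G.edgeSet → Sym2 V) f (tails f)),
    graphOf (contraction (Subtype.val : G.edgeSet → Sym2 V) f hsurj), hK.equiv, hL.equiv ∘ f ∘ hK.equiv.symm,
    hL.equiv.symm, ?_, ⟨hisoK, hK.equiv.bijective, ?_⟩, ?_, ⟨hisoL, ?_, ?_⟩,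
    replacesChains_regroup hL hK hfin, ?_, ⟨⟨hf.not_isIsolated, hL.equiv.symm.surjective, ?_⟩,
      hL.equiv.symm.injective⟩⟩
  · funext e
    simp
  · intro C
    rw [hK.isCircuit_image, heven, isCircuit_iff]
  · intro hV
    refine switchEquiv_regroup fun e he => exists_cut (fun h => he h.symm) ?_ ?_
    · exact fun C hC heC => hsat C hC e heC _ (apply_lead f e).symm
    · obtain ⟨C, hC, heC, -⟩ := hG.linked e e
      exact ⟨C, hC.1, heC⟩
  · exact hL.equiv.surjective.comp (hsurj.comp hK.equiv.symm.surjective)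
  · intro C hC
    rw [← hK.equiv.image_symm_image C, hK.isCircuit_image, heven] at hC
    rw [Set.image_comp, Set.image_comp, hL.isCircuit_image]
    exact isMinimalMember_image hsurj hsat hC
  · intro D hD
    rw [← hL.equiv.image_symm_image D, hL.isCircuit_image] at hD
    rw [← hL.equiv.image_symm_image D, hpre, hK.isCircuit_image, heven]
    exact isMinimalMember_preimage hsurj hsat hD
  · intro D hD
    rw [← hL.equiv.image_symm_image D, hL.isCircuit_image] at hD
    -- A circuit of `L` is the image of its preimage in `G`, which is a circuit, so `f` carries it
    -- to a circuit of `H`.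
    have := hf.map_circuit _ (isCircuit_iff.2 (isMinimalMember_preimage hsurj hsat hD))
    rwa [Set.image_preimage_eq _ hsurj] at this
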